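/- For a trigonometric polynomial $p$ let $\mathcal C_p\subset\mathbb R^2$ be the image of $[-\pi,\pi]$ under $\gamma(\theta)=(p(\theta)\cos\theta-p'(\theta)\sin\theta,\ p(\theta)\sin\theta+p'(\theta)\cos\theta)$. For an integer $n\ge 3$ and $\rho>0$, an algebraic rotor of a regular $n$-gon with apothem $\rho$ is a curve $\mathcal C_p$ where $p+p''\ge 0$ on $\mathbb R$ and, for some integer $m\ge 0$ and some real coefficients, $$p(\theta)=\rho+\sum_{k=0}^{m}\bigl(a_{kn+1}\cos((kn+1)\theta)+b_{kn+1}\sin((kn+1)\theta)+a_{kn-1}\cos((kn-1)\theta)+b_{kn-1}\sin((kn-1)\theta)\bigr).$$ Let $\mathcal R$ be the set of all algebraic rotors, for all $n\ge 3$ and all $\rho>0$. A defining polynomial of a curve $\mathcal C$ is an irreducible $f\in\mathbb R[x,y]$ such that the polynomials in $\mathbb R[x,y]$ vanishing on $\mathcal C$ are exactly the multiples of $f$; it is unique up to a nonzero constant factor. **Theorem.** Every curve of $\mathcal R$ that is not a circle has a defining polynomial, and the minimum of the total degrees of the defining polynomials of all non-circular curves of $\mathcal R$ is $6$. Moreover,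 let $p(\theta)=\tfrac12+a_1\cos\theta+b_1\sin\theta+a_2\cos2\theta+b_2\sin2\theta$ with real coefficients. If $(a_2,b_2)\neq(0,0)$ and $p+p''\ge0$, then $\mathcal C_p$ is a non-circular algebraic rotor of a regular triangle with apothem $\tfrac12$, and its defining polynomial has total degree $6$. There is $\varepsilon>0$ such that $p+p''\ge 0$ whenever $|a_2|<\varepsilon$ and $|b_2|<\varepsilon$, for all $a_1,b_1$. In particular $p(\theta)=\tfrac12+\tfrac16\cos2\theta$ satisfies $p+p''\ge0$, and $\mathcal C_p$ is a non-circular algebraic rotor of a regular triangle with apothem $\tfrac12$ whose defining polynomial has total degree $6$. -/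

import Mathlib

open scoped BigOperators

noncomputable section

/-- The Euclidean plane. -/
abbrev Plane : Type := EuclideanSpace ℝ (Fin 2)

/-- `γ(θ) = (p(θ) cos θ - p'(θ) sin θ, p(θ) sin θ + p'(θ) cos θ)`. -/
def supportParam (p : ℝ → ℝ) (θ : ℝ) : Plane :=
  !₂[p θ * Real.cos θ - deriv p θ * Real.sin θ, p θ * Real.sin θ + deriv p θ * Real.cos θ]

/-- The planar curve traced by `γ` on `[-π, π]`. -/
def supportCurve (p : ℝ → ℝ) : Set Plane :=
  supportParam p '' Set.Icc (-Real.pi) Real.pi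

/-- The convexity constraint `p + p'' ≥ 0` (used for smooth `p` only). -/
def ConvexityConstraint (p : ℝ → ℝ) : Prop :=
  ∀ θ : ℝ, 0 ≤ p θ + deriv (deriv p) θ

/-- The trigonometric polynomial with constant term `ρ` and harmonics of order `kn ± 1`,
`0 ≤ k ≤ m`; the coefficients of `cos jθ` and `sin jθ` are `a j` and `b j`. -/
def rotorSupport (n : ℕ) (ρ : ℝ) (m : ℕ) (a b : ℤ → ℝ) (θ : ℝ) : ℝ :=
  ρ + ∑ k ∈ Finset.range (m + 1),
    (a ((k : ℤ) * n + 1) * Real.cos (((k : ℝ) * n + 1) * θ)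
      + b ((k : ℤ) * n + 1) * Real.sin (((k : ℝ) * n + 1) * θ)
      + a ((k : ℤ) * n - 1) * Real.cos (((k : ℝ) * n - 1) * θ)
      + b ((k : ℤ) * n - 1) * Real.sin (((k : ℝ) * n - 1) * θ))

/-- `C` is an algebraic rotor of a regular `n`-gon with apothem `ρ`. -/
def IsAlgebraicRotor (n : ℕ) (ρ : ℝ) (C : Set Plane) : Prop :=
  3 ≤ n ∧ 0 < ρ ∧ ∃ (m : ℕ) (a b : ℤ → ℝ),
    ConvexityConstraint (rotorSupport n ρ m a b) ∧ C = supportCurve (rotorSupport n ρ m a b)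

/-- The set of all planar algebraic rotors, for all `n ≥ 3` and all apothems `ρ > 0`. -/
def algebraicRotors : Set (Set Plane) :=
  {C | ∃ (n : ℕ) (ρ : ℝ), IsAlgebraicRotor n ρ C}

/-- `C` is a circle of positive radius. -/
def IsCircle (C : Set Plane) : Prop :=
  ∃ (c : Plane) (r : ℝ), 0 < r ∧ C = Metric.sphere c r

/-- `f ∈ ℝ[x, y]` is a defining polynomial of `C`: it is irreducible, and the polynomials that
vanish on `C` are exactly the multiples of `f`. In particular `f` is unique up to a nonzero
constant factor. -/
def IsDefiningPolynomial (f : MvPolynomial (Fin 2) ℝ) (C : Set Plane) : Prop :=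
  Irreducible f ∧
    ∀ g : MvPolynomial (Fin 2) ℝ, (∀ z ∈ C, MvPolynomial.eval (fun i => z i) g = 0) ↔ f ∣ g

/-- `p(θ) = 1/2 + a₁ cos θ + b₁ sin θ + a₂ cos 2θ + b₂ sin 2θ`. -/
def quadraticSupport (a₁ b₁ a₂ b₂ : ℝ) (θ : ℝ) : ℝ :=
  1 / 2 + a₁ * Real.cos θ + b₁ * Real.sin θ + a₂ * Real.cos (2 * θ) + b₂ * Real.sin (2 * θ)

end

/-!
Along the curve of `p(θ) = P(e^{iθ})` the isotropic coordinates `x ± iy` are Laurent polynomials in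
`e^{iθ}`, and the harmonics of `p` of order one only translate the curve. A polynomial vanishing on
the curve is therefore, after a linear substitution, an `F` that vanishes at these two Laurent
polynomials.

If `N ≥ 2` is the top frequency of `p`, the degrees of `x + iy` and `x - iy` are `N + 1` and
`N - 1` in `e^{iθ}`, and `N - 1` and `N + 1` in `e^{-iθ}`. The top coefficients must cancel, so the
faces of the Newton polygon of `F` with outer normals `(N + 1, N - 1)` and `(N - 1, N + 1)` have
at least two monomials each. Two monomials on the first face have second exponents that differ by
a multiple of `(N + 1) / gcd(N + 1, N - 1)`, which is at least `3` unless `N = 3`; symmetrically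
for the other face and the first exponents. Comparing the two faces yields a monomial of degree at
least `6`. If `N = 3`, the polygon is a square and all exponents of `P` are multiples of `3`; then
degree less than `6` leaves a face with exactly two monomials, and the two leading coefficients of
`x ± iy`, taken together as a dual number, do not allow these to cancel.

The vanishing ideal of the curve is a nonzero prime of the factorial ring `ℝ[x, y]`, strictly
contained in that of a point, so it has height one and is generated by an irreducible polynomial.

For the upper bound, let `u = a₂ cos 2θ + b₂ sin 2θ`. Two quadratic polynomials in `x, y` are
polynomials in `u` of degrees `2` and `3` along the curve; eliminating `u` gives a sextic.
-/

open scoped LaurentPolynomial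
open LaurentPolynomial (T invert)

section LeadingTerms

variable {R : Type*} [CommRing R]

/-- `f = c₀ T ^ d + c₁ T ^ (d - q) + O(T ^ (d - 2q))`, where the two leading coefficients are stored
as the dual number `c = c₀ + c₁ ε`, so that they multiply like dual numbers. Both may vanish. -/
def HasLeadingTerms (q : ℤ) (f : R[T;T⁻¹]) (d : ℤ) (c : DualNumber R) : Prop :=
  f - (LaurentPolynomial.C c.fst * T d + LaurentPolynomial.C c.snd * T (d - q)) ∈
    AddMonoidAlgebra.supported R R (Set.Iic (d - 2 * q))

theorem mul_mem_supported_Iic {f g : R[T;T⁻¹]} {d e n : ℤ}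
    (hf : f ∈ AddMonoidAlgebra.supported R R (Set.Iic d))
    (hg : g ∈ AddMonoidAlgebra.supported R R (Set.Iic e)) (h : d + e ≤ n) :
    f * g ∈ AddMonoidAlgebra.supported R R (Set.Iic n) := by
  classical
  intro k hk
  obtain ⟨i, hi, j, hj, rfl⟩ := Finset.mem_add.mp (AddMonoidAlgebra.support_coeff_mul_subset f g hk)
  exact (add_le_add (hf hi) (hg hj)).trans h

theorem C_mul_T_mem_supported_Iic (c : R) {d n : ℤ} (h : d ≤ n) :
    LaurentPolynomial.C c * T d ∈ AddMonoidAlgebra.supported R R (Set.Iic n) := by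
  intro k hk
  obtain rfl := Finset.mem_singleton.mp (LaurentPolynomial.support_C_mul_T c d hk)
  exact h

theorem coeff_C_mul_T (c : R) (d e : ℤ) :
    (LaurentPolynomial.C c * T d).coeff e = if d = e then c else 0 := by
  rw [← LaurentPolynomial.single_eq_C_mul_T, AddMonoidAlgebra.coeff_single, Finsupp.single_apply]

namespace HasLeadingTerms

variable {q d e : ℤ} {f g : R[T;T⁻¹]} {c c' : DualNumber R}

theorem coeff_eq (h : HasLeadingTerms q f d c) (he : d - 2 * q < e) :
    f.coeff e = (if d = e then c.fst else 0) + if d - q = e then c.snd else 0 := by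
  have := AddMonoidAlgebra.mem_supported'.mp h e he.not_ge
  simpa [sub_eq_zero, coeff_C_mul_T] using this

theorem of_coeff (hq : 0 < q)
    (hf : ∀ k, f.coeff k ≠ 0 → k = d ∨ k = d - q ∨ k ≤ d - 2 * q) :
    HasLeadingTerms q f d (.inl (f.coeff d) + .inr (f.coeff (d - q))) := by
  refine AddMonoidAlgebra.mem_supported'.mpr fun k hk => ?_
  rw [Set.mem_Iic, not_le] at hk
  have hne : d - q ≠ d := by lia
  rcases eq_or_ne d k with rfl | hd
  · simp [coeff_C_mul_T, hne]
  rcases eq_or_ne (d - q) k with rfl | hdq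
  · simp [coeff_C_mul_T, hd]
  have hk0 : f.coeff k = 0 := by
    by_contra h
    have := hf k h
    lia
  simp [coeff_C_mul_T, hd, hdq, hk0]

theorem mem_supported (hq : 0 ≤ q) (h : HasLeadingTerms q f d c) :
    f ∈ AddMonoidAlgebra.supported R R (Set.Iic d) := by
  refine AddMonoidAlgebra.mem_supported'.mpr fun k hk => ?_
  rw [Set.mem_Iic, not_le] at hk
  rw [h.coeff_eq (by lia), if_neg (by lia), if_neg (by lia), add_zero]

theorem one : HasLeadingTerms q (1 : R[T;T⁻¹]) 0 1 := by
  simp [HasLeadingTerms]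

theorem mul (hq : 0 ≤ q) (hf : HasLeadingTerms q f d c) (hg : HasLeadingTerms q g e c') :
    HasLeadingTerms q (f * g) (d + e) (c * c') := by
  set L := LaurentPolynomial.C c.fst * T d + LaurentPolynomial.C c.snd * T (d - q) with hL
  set L' := LaurentPolynomial.C c'.fst * T e + LaurentPolynomial.C c'.snd * T (e - q) with hL'
  have hLd : L ∈ AddMonoidAlgebra.supported R R (Set.Iic d) :=
    add_mem (C_mul_T_mem_supported_Iic _ le_rfl) (C_mul_T_mem_supported_Iic _ (by lia))
  have hprod : f * g - (LaurentPolynomial.C (c * c').fst * T (d + e) +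
      LaurentPolynomial.C (c * c').snd * T (d + e - q)) =
      (f - L) * g + L * (g - L') +
        LaurentPolynomial.C (c.snd * c'.snd) * T (d + e - 2 * q) := by
    have hT : (T (-(2 * q)) : R[T;T⁻¹]) = T (-q) * T (-q) := by
      rw [← LaurentPolynomial.T_add]
      ring_nf
    simp only [hL, hL', TrivSqZeroExt.fst_mul, DualNumber.snd_mul, map_add, map_mul,
      LaurentPolynomial.T_sub, LaurentPolynomial.T_add, hT]
    ring
  unfold HasLeadingTerms
  rw [hprod]
  exact add_mem (add_mem (mul_mem_supported_Iic hf (hg.mem_supported hq) (by lia))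
    (mul_mem_supported_Iic hLd hg (by lia))) (C_mul_T_mem_supported_Iic _ le_rfl)

theorem pow (hq : 0 ≤ q) (hf : HasLeadingTerms q f d c) (n : ℕ) :
    HasLeadingTerms q (f ^ n) (n * d) (c ^ n) := by
  induction n with
  | zero => simpa using one
  | succ n ih =>
    simpa only [pow_succ, Nat.cast_succ, add_mul, one_mul] using ih.mul hq hf

end HasLeadingTerms

end LeadingTerms

section NewtonFace

variable {R : Type*} [CommRing R]

/-- The linear functional `(a, b)` on the exponents of bivariate monomials. -/
def weight (a b : ℤ) (m : Fin 2 →₀ ℕ) : ℤ := m 0 * a + m 1 * b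

/-- The exponents on the face of the Newton polygon of `F` with outer normal `(a, b)`. -/
def newtonFace (F : MvPolynomial (Fin 2) R) (a b : ℤ) : Finset (Fin 2 →₀ ℕ) :=
  {m ∈ F.support | ∀ m' ∈ F.support, weight a b m' ≤ weight a b m}

variable {F : MvPolynomial (Fin 2) R} {a b : ℤ} {m m' : Fin 2 →₀ ℕ}

theorem mem_newtonFace : m ∈ newtonFace F a b ↔
    m ∈ F.support ∧ ∀ m' ∈ F.support, weight a b m' ≤ weight a b m := by
  rw [newtonFace, Finset.mem_filter]

theorem newtonFace_nonempty (hF : F ≠ 0) (a b : ℤ) : (newtonFace F a b).Nonempty := by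
  obtain ⟨m, hm, hmax⟩ :=
    F.support.exists_max_image (weight a b) (MvPolynomial.support_nonempty.mpr hF)
  exact ⟨m, mem_newtonFace.mpr ⟨hm, hmax⟩⟩

theorem weight_eq_of_mem_newtonFace (hm : m ∈ newtonFace F a b) (hm' : m' ∈ newtonFace F a b) :
    weight a b m = weight a b m' := by
  rw [mem_newtonFace] at hm hm'
  exact (hm'.2 m hm.1).antisymm (hm.2 m' hm'.1)

theorem weight_lt_of_notMem_newtonFace (hm : m ∈ newtonFace F a b) (hm' : m' ∈ F.support)
    (h : m' ∉ newtonFace F a b) : weight a b m' < weight a b m := by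
  rw [mem_newtonFace] at hm
  refine lt_of_le_of_ne (hm.2 m' hm') fun heq => h (mem_newtonFace.mpr ⟨hm', fun k hk => ?_⟩)
  exact (hm.2 k hk).trans_eq heq.symm

theorem add_le_totalDegree_of_mem_newtonFace (hm : m ∈ newtonFace F a b) :
    m 0 + m 1 ≤ F.totalDegree := by
  have := MvPolynomial.le_totalDegree (mem_newtonFace.mp hm).1
  rwa [Finsupp.sum_fintype _ _ fun _ => rfl, Fin.sum_univ_two] at this

theorem apply_zero_le_of_mem_newtonFace_swap (hb : 0 ≤ b) (hab : b < a)
    (hm : m ∈ newtonFace F a b) (hm' : m' ∈ newtonFace F b a) : m' 0 ≤ m 0 := by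
  have h₁ := (mem_newtonFace.mp hm).2 m' (mem_newtonFace.mp hm').1
  have h₂ := (mem_newtonFace.mp hm').2 m (mem_newtonFace.mp hm).1
  simp only [weight] at h₁ h₂
  by_contra! hlt
  zify at hlt
  nlinarith [mul_pos (sub_pos.mpr hlt) (sub_pos.mpr hab)]

theorem le_apply_of_one_lt_card_of_line {ι : Type*} {S : Finset ι} (hS : 1 < S.card)
    {x y : ι → ℕ} (hxy : ∀ i ∈ S, ∀ j ∈ S, x i = x j → y i = y j → i = j) {a b c : ℤ} (ha : a ≠ 0)
    (hline : ∀ i ∈ S, x i * a + y i * b = c) {d : ℕ}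
    (hd : ∀ u v : ℤ, u * a = v * b → (d : ℤ) ∣ v) : ∃ i ∈ S, d ≤ y i := by
  obtain ⟨i, hi, j, hj, hij⟩ := Finset.one_lt_card.mp hS
  wlog hji : y j ≤ y i generalizing i j
  · exact this j hj i hi hij.symm (le_of_not_ge hji)
  have hdvd : (d : ℤ) ∣ y i - y j :=
    hd (x j - x i) _ (by linear_combination hline j hj - hline i hi)
  have hpos : (0 : ℤ) < y i - y j := by
    refine sub_pos.mpr (Nat.cast_lt.mpr (lt_of_le_of_ne hji fun hy => hij ?_))
    refine hxy i hi j hj ?_ hy.symm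
    have := hline i hi
    rw [← hline j hj, hy, add_left_inj, mul_left_inj' ha] at this
    exact_mod_cast this
  have := Int.le_of_dvd hpos hdvd
  exact ⟨i, hi, by lia⟩

theorem exists_mem_newtonFace_le_apply_one (h : 1 < (newtonFace F a b).card) (ha : a ≠ 0) {d : ℕ}
    (hd : ∀ u v : ℤ, u * a = v * b → (d : ℤ) ∣ v) : ∃ m ∈ newtonFace F a b, d ≤ m 1 := by
  obtain ⟨m₀, hm₀⟩ := Finset.card_pos.mp (zero_lt_one.trans h)
  exact le_apply_of_one_lt_card_of_line h (x := fun m => m 0) (y := fun m => m 1)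
    (fun i _ j _ h₀ h₁ => Finsupp.ext (Fin.forall_fin_two.mpr ⟨h₀, h₁⟩)) ha
    (fun m hm => weight_eq_of_mem_newtonFace hm hm₀) hd

theorem exists_mem_newtonFace_le_apply_zero (h : 1 < (newtonFace F b a).card) (ha : a ≠ 0) {d : ℕ}
    (hd : ∀ u v : ℤ, u * a = v * b → (d : ℤ) ∣ v) : ∃ m ∈ newtonFace F b a, d ≤ m 0 := by
  obtain ⟨m₀, hm₀⟩ := Finset.card_pos.mp (zero_lt_one.trans h)
  exact le_apply_of_one_lt_card_of_line h (x := fun m => m 1) (y := fun m => m 0)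
    (fun i _ j _ h₁ h₀ => Finsupp.ext (Fin.forall_fin_two.mpr ⟨h₀, h₁⟩)) ha
    (fun m hm => (add_comm _ _).trans (weight_eq_of_mem_newtonFace hm hm₀)) hd

variable {q : ℤ} {Z W : R[T;T⁻¹]} {z w : DualNumber R}

theorem HasLeadingTerms.pow_mul_pow (hq : 0 ≤ q) (hZ : HasLeadingTerms q Z a z)
    (hW : HasLeadingTerms q W b w) (m : Fin 2 →₀ ℕ) :
    HasLeadingTerms q (Z ^ m 0 * W ^ m 1) (weight a b m) (z ^ m 0 * w ^ m 1) :=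
  (hZ.pow hq _).mul hq (hW.pow hq _)

theorem coeff_aeval_pair (F : MvPolynomial (Fin 2) R) (Z W : R[T;T⁻¹]) (k : ℤ) :
    (MvPolynomial.aeval ![Z, W] F).coeff k =
      ∑ m ∈ F.support, F.coeff m * (Z ^ m 0 * W ^ m 1).coeff k := by
  simp only [MvPolynomial.aeval_def, MvPolynomial.eval₂_eq', Fin.prod_univ_two,
    Matrix.cons_val_zero, Matrix.cons_val_one, AddMonoidAlgebra.coeff_sum, Finsupp.finsetSum_apply]
  refine Finset.sum_congr rfl fun m _ => ?_
  rw [← Algebra.smul_def, AddMonoidAlgebra.coeff_smul, Finsupp.smul_apply, smul_eq_mul]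

theorem sum_newtonFace_fst_eq_zero (hq : 0 < q) (hZ : HasLeadingTerms q Z a z)
    (hW : HasLeadingTerms q W b w) (hF : MvPolynomial.aeval ![Z, W] F = 0) :
    ∑ m ∈ newtonFace F a b, F.coeff m * (z ^ m 0 * w ^ m 1).fst = 0 := by
  obtain hempty | ⟨m₀, hm₀⟩ := (newtonFace F a b).eq_empty_or_nonempty
  · rw [hempty, Finset.sum_empty]
  have hcoeff := coeff_aeval_pair F Z W (weight a b m₀)
  rw [hF, AddMonoidAlgebra.coeff_zero, Finsupp.zero_apply] at hcoeff
  rw [hcoeff]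
  refine Finset.sum_subset_zero_on_sdiff (Finset.filter_subset _ _) (fun m hm => ?_) fun m hm => ?_
  · obtain ⟨hm, hm'⟩ := Finset.mem_sdiff.mp hm
    have hlt := weight_lt_of_notMem_newtonFace hm₀ hm hm'
    rw [(hZ.pow_mul_pow hq.le hW m).coeff_eq (by lia), if_neg (by lia), if_neg (by lia), add_zero,
      mul_zero]
  · have heq := weight_eq_of_mem_newtonFace hm hm₀
    rw [(hZ.pow_mul_pow hq.le hW m).coeff_eq (by lia), if_pos heq, if_neg (by lia), add_zero]

theorem sum_newtonFace_smul_eq_zero (hq : 0 < q) (hZ : HasLeadingTerms q Z a z)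
    (hW : HasLeadingTerms q W b w) (hF : MvPolynomial.aeval ![Z, W] F = 0)
    (hgap : ∀ m m' : Fin 2 →₀ ℕ, weight a b m ≠ weight a b m' - q) :
    ∑ m ∈ newtonFace F a b, F.coeff m • (z ^ m 0 * w ^ m 1) = 0 := by
  obtain hempty | ⟨m₀, hm₀⟩ := (newtonFace F a b).eq_empty_or_nonempty
  · rw [hempty, Finset.sum_empty]
  have hcoeff := coeff_aeval_pair F Z W (weight a b m₀ - q)
  rw [hF, AddMonoidAlgebra.coeff_zero, Finsupp.zero_apply] at hcoeff
  ext
  · simpa only [TrivSqZeroExt.fst_sum, TrivSqZeroExt.fst_smul, smul_eq_mul, TrivSqZeroExt.fst_zero]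
      using sum_newtonFace_fst_eq_zero hq hZ hW hF
  · rw [TrivSqZeroExt.snd_sum, TrivSqZeroExt.snd_zero, hcoeff]
    refine Finset.sum_subset_zero_on_sdiff (Finset.filter_subset _ _) (fun m hm => ?_)
      fun m hm => ?_
    · obtain ⟨hm, hm'⟩ := Finset.mem_sdiff.mp hm
      have hlt := weight_lt_of_notMem_newtonFace hm₀ hm hm'
      rw [(hZ.pow_mul_pow hq.le hW m).coeff_eq (by lia), if_neg (hgap m m₀), if_neg (by lia),
        add_zero, mul_zero]
    · have heq := weight_eq_of_mem_newtonFace hm hm₀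
      rw [(hZ.pow_mul_pow hq.le hW m).coeff_eq (by lia), if_neg (hgap m m₀), if_pos (by lia),
        zero_add, TrivSqZeroExt.snd_smul, smul_eq_mul]

theorem one_lt_card_newtonFace [IsDomain R] (hq : 0 < q) (hZ : HasLeadingTerms q Z a z)
    (hW : HasLeadingTerms q W b w) (hz : z.fst ≠ 0) (hw : w.fst ≠ 0) (hF₀ : F ≠ 0)
    (hF : MvPolynomial.aeval ![Z, W] F = 0) : 1 < (newtonFace F a b).card := by
  by_contra! hcard
  obtain ⟨m, hm⟩ := newtonFace_nonempty hF₀ a b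
  have hface : newtonFace F a b = {m} :=
    Finset.eq_singleton_iff_unique_mem.mpr ⟨hm, fun k hk => Finset.card_le_one.mp hcard k hk m hm⟩
  have hsum := sum_newtonFace_fst_eq_zero hq hZ hW hF
  rw [hface, Finset.sum_singleton, TrivSqZeroExt.fst_mul, TrivSqZeroExt.fst_pow,
    TrivSqZeroExt.fst_pow] at hsum
  have hcoeff := MvPolynomial.mem_support_iff.mp (mem_newtonFace.mp hm).1
  exact mul_ne_zero hcoeff (mul_ne_zero (pow_ne_zero _ hz) (pow_ne_zero _ hw)) hsum

end NewtonFace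

section SixLeTotalDegree

variable {K : Type*} [Field K] {F : MvPolynomial (Fin 2) K} {Z W : K[T;T⁻¹]}

theorem exists_three_le_forall_dvd {N : ℤ} (hN : 2 ≤ N) (hN₃ : N ≠ 3) : ∃ d : ℕ, 3 ≤ d ∧
    ∀ u v : ℤ, u * (N + 1) = v * (N - 1) → (d : ℤ) ∣ v := by
  obtain ⟨M, rfl | rfl⟩ := Int.even_or_odd' N
  · refine ⟨(2 * M + 1).toNat, by lia, fun u v h => ?_⟩
    rw [Int.toNat_of_nonneg (by lia)]
    have hcoprime : IsCoprime (2 * M + 1) (2 * M - 1) := ⟨1 - M, M, by ring⟩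
    exact hcoprime.dvd_of_dvd_mul_right ⟨u, by linarith⟩
  · refine ⟨(M + 1).toNat, by lia, fun u v h => ?_⟩
    rw [Int.toNat_of_nonneg (by lia)]
    have hcoprime : IsCoprime (M + 1) M := ⟨1, -1, by ring⟩
    exact hcoprime.dvd_of_dvd_mul_right ⟨u, by linarith⟩

theorem newtonFace_four_two_eq_pair (hdeg : F.totalDegree < 6)
    (hcard : 1 < (newtonFace F 4 2).card) (hx : ∀ m ∈ newtonFace F 4 2, 2 ≤ m 0)
    {m : Fin 2 →₀ ℕ} (hm : m ∈ newtonFace F 4 2) (hm₁ : 2 ≤ m 1) :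
    ∃ m', m' ≠ m ∧ newtonFace F 4 2 = {m, m'} ∧ m' 0 = m 0 + 1 ∧ m 1 = m' 1 + 2 := by
  have hline : ∀ k ∈ newtonFace F 4 2, k ≠ m → k 0 = m 0 + 1 ∧ m 1 = k 1 + 2 := by
    intro k hk hkm
    have hweight := weight_eq_of_mem_newtonFace hk hm
    have hdeg_m := add_le_totalDegree_of_mem_newtonFace hm
    have hdeg_k := add_le_totalDegree_of_mem_newtonFace hk
    have hx_m := hx m hm
    have hx_k := hx k hk
    have hne : k 0 ≠ m 0 ∨ k 1 ≠ m 1 := by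
      contrapose! hkm
      exact Finsupp.ext (Fin.forall_fin_two.mpr hkm)
    simp only [weight] at hweight
    lia
  obtain ⟨m', hm', hne⟩ := Finset.exists_mem_ne hcard m
  refine ⟨m', hne, Finset.Subset.antisymm (fun k hk => ?_) ?_, hline m' hm' hne⟩
  · rw [Finset.mem_insert, Finset.mem_singleton, or_iff_not_imp_left]
    intro hkm
    refine Finsupp.ext (Fin.forall_fin_two.mpr ?_)
    have := hline k hk hkm
    have := hline m' hm' hne
    lia
  · exact Finset.insert_subset hm (Finset.singleton_subset_iff.mpr hm')

theorem six_le_totalDegree_of_gap_three [CharZero K] {g ρ : K} (hg : g ≠ 0) (hρ : ρ ≠ 0)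
    (hZ : HasLeadingTerms 3 Z 4 (.inl (-2 * g) + .inr ρ))
    (hW : HasLeadingTerms 3 W 2 (.inl (4 * g) + .inr ρ))
    (hF₀ : F ≠ 0) (hF : MvPolynomial.aeval ![Z, W] F = 0)
    (hx : ∀ m ∈ newtonFace F 4 2, 2 ≤ m 0) : 6 ≤ F.totalDegree := by
  set z : DualNumber K := .inl (-2 * g) + .inr ρ with hz
  set w : DualNumber K := .inl (4 * g) + .inr ρ with hw
  have hz₀ : z.fst ≠ 0 := by simpa [hz]
  have hw₀ : w.fst ≠ 0 := by simpa [hw]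
  by_contra! hdeg
  have hcard := one_lt_card_newtonFace (by norm_num) hZ hW hz₀ hw₀ hF₀ hF
  obtain ⟨m, hm, hm₁⟩ : ∃ m ∈ newtonFace F 4 2, 2 ≤ m 1 :=
    exists_mem_newtonFace_le_apply_one hcard (by norm_num) fun u v h => ⟨u, by lia⟩
  obtain ⟨m', hne, hface, hm'₀, hm'₁⟩ := newtonFace_four_two_eq_pair hdeg hcard hx hm hm₁
  have hsum := sum_newtonFace_smul_eq_zero (by norm_num) hZ hW hF
    fun k k' => by simp only [weight]; lia
  rw [hface, Finset.sum_pair hne.symm, hm'₀, hm'₁] at hsum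
  have hunit : IsUnit (z ^ m 0 * w ^ m' 1) :=
    ((TrivSqZeroExt.isUnit_iff_isUnit_fst.mpr hz₀.isUnit).pow _).mul
      ((TrivSqZeroExt.isUnit_iff_isUnit_fst.mpr hw₀.isUnit).pow _)
  have hpair : F.coeff m • w ^ 2 + F.coeff m' • z = 0 := by
    refine hunit.mul_left_eq_zero.mp ?_
    rw [← hsum]
    simp only [Algebra.smul_def]
    ring
  have hfst := congrArg TrivSqZeroExt.fst hpair
  have hsnd := congrArg TrivSqZeroExt.snd hpair
  simp only [hz, hw, pow_two, TrivSqZeroExt.fst_add, TrivSqZeroExt.fst_smul, TrivSqZeroExt.fst_mul,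
    TrivSqZeroExt.fst_inl, TrivSqZeroExt.fst_inr, TrivSqZeroExt.fst_zero, TrivSqZeroExt.snd_add,
    TrivSqZeroExt.snd_smul, DualNumber.snd_mul, TrivSqZeroExt.snd_inl, TrivSqZeroExt.snd_inr,
    TrivSqZeroExt.snd_zero, smul_eq_mul, add_zero, zero_add] at hfst hsnd
  have hm_coeff : F.coeff m ≠ 0 := MvPolynomial.mem_support_iff.mp (mem_newtonFace.mp hm).1
  have hprod : 32 * g ^ 2 * ρ * F.coeff m = 0 := by
    linear_combination ρ * hfst + 2 * g * hsnd
  simp [hg, hρ, hm_coeff] at hprod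

end SixLeTotalDegree

section CurveCoordinates

variable {R : Type*} [CommRing R]

/-- The Euler operator `T d/dT` on Laurent polynomials. -/
noncomputable def euler (P : R[T;T⁻¹]) : R[T;T⁻¹] :=
  P.coeff.sum fun k c => LaurentPolynomial.C (k * c) * T k

/-- The coordinate `x + iy` of the curve with support function `p(θ) = P(e^{iθ})`, as a Laurent
polynomial in `e^{iθ}`: it is `(p + ip')e^{iθ}`, and `p' = i (euler P)(e^{iθ})`. -/
noncomputable def curvePlus (P : R[T;T⁻¹]) : R[T;T⁻¹] := (P - euler P) * T 1

/-- The coordinate `x - iy` of the curve with support function `p(θ) = P(e^{iθ})`, as a Laurent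
polynomial in `e^{iθ}`. -/
noncomputable def curveMinus (P : R[T;T⁻¹]) : R[T;T⁻¹] := (P + euler P) * T (-1)

variable (P : R[T;T⁻¹])

theorem coeff_euler (k : ℤ) : (euler P).coeff k = k * P.coeff k := by
  simp only [euler, Finsupp.sum, AddMonoidAlgebra.coeff_sum, Finsupp.finsetSum_apply,
    coeff_C_mul_T, Finset.sum_ite_eq', Finsupp.mem_support_iff]
  split_ifs with h
  · rfl
  · rw [Finsupp.notMem_support_iff.mp h, mul_zero]

theorem coeff_mul_T (n k : ℤ) : (P * T n).coeff k = P.coeff (k - n) := by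
  rw [T, AddMonoidAlgebra.coeff_mul_single_apply, mul_one, sub_eq_add_neg]

theorem coeff_curvePlus (k : ℤ) : (curvePlus P).coeff k = (2 - k) * P.coeff (k - 1) := by
  rw [curvePlus, coeff_mul_T, AddMonoidAlgebra.coeff_sub, Finsupp.sub_apply, coeff_euler]
  push_cast
  ring

theorem coeff_curveMinus (k : ℤ) : (curveMinus P).coeff k = (2 + k) * P.coeff (k + 1) := by
  rw [curveMinus, coeff_mul_T, AddMonoidAlgebra.coeff_add, Finsupp.add_apply, coeff_euler,
    sub_neg_eq_add]
  push_cast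
  ring

theorem invert_curvePlus : invert (curvePlus P) = curveMinus (invert P) := by
  refine LaurentPolynomial.ext fun k => ?_
  rw [LaurentPolynomial.invert_apply, coeff_curvePlus, coeff_curveMinus,
    LaurentPolynomial.invert_apply, neg_add']
  push_cast
  ring

theorem invert_curveMinus : invert (curveMinus P) = curvePlus (invert P) := by
  refine LaurentPolynomial.ext fun k => ?_
  rw [LaurentPolynomial.invert_apply, coeff_curvePlus, coeff_curveMinus,
    LaurentPolynomial.invert_apply, neg_sub', sub_neg_eq_add]
  push_cast
  ring

variable (Q : R[T;T⁻¹]) (c : R) (n : ℤ)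

theorem euler_add : euler (P + Q) = euler P + euler Q := by
  refine LaurentPolynomial.ext fun k => ?_
  simp only [coeff_euler, AddMonoidAlgebra.coeff_add, Finsupp.add_apply, mul_add]

theorem euler_C_mul_T :
    euler (LaurentPolynomial.C c * T n) = LaurentPolynomial.C (n * c) * T n := by
  refine LaurentPolynomial.ext fun k => ?_
  rw [coeff_euler, coeff_C_mul_T, coeff_C_mul_T]
  split_ifs with h
  · rw [h]
  · rw [mul_zero]

theorem curvePlus_add : curvePlus (P + Q) = curvePlus P + curvePlus Q := by
  rw [curvePlus, curvePlus, curvePlus, euler_add]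
  ring

theorem curveMinus_add : curveMinus (P + Q) = curveMinus P + curveMinus Q := by
  rw [curveMinus, curveMinus, curveMinus, euler_add]
  ring

theorem curvePlus_C_mul_T :
    curvePlus (LaurentPolynomial.C c * T n) =
      LaurentPolynomial.C ((1 - n) * c) * T (n + 1) := by
  rw [curvePlus, euler_C_mul_T, one_sub_mul, map_sub, LaurentPolynomial.T_add]
  ring

theorem curveMinus_C_mul_T :
    curveMinus (LaurentPolynomial.C c * T n) =
      LaurentPolynomial.C ((1 + n) * c) * T (n - 1) := by
  rw [curveMinus, euler_C_mul_T, one_add_mul, map_add, sub_eq_add_neg,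
    LaurentPolynomial.T_add]
  ring

end CurveCoordinates

/-- `P` has extreme exponents `N` and `-N`, as does the Laurent polynomial of a noncircular rotor
of a regular polygon once its harmonics of order one are removed. If `N = 3`, the polygon is a
square, which has no harmonics of order two. -/
structure IsRotorSpectrum {R : Type*} [CommRing R] (P : R[T;T⁻¹]) (N : ℤ) : Prop where
  two_le : 2 ≤ N
  coeff_eq_zero : ∀ k, N < |k| → P.coeff k = 0
  coeff_top_ne_zero : P.coeff N ≠ 0
  coeff_bot_ne_zero : P.coeff (-N) ≠ 0
  coeff_zero_ne_zero : P.coeff 0 ≠ 0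
  three_dvd : N = 3 → ∀ k, P.coeff k ≠ 0 → 3 ∣ k

namespace IsRotorSpectrum

variable {K : Type*} [Field K] {P : K[T;T⁻¹]} {N : ℤ}

theorem invert (hP : IsRotorSpectrum P N) : IsRotorSpectrum (LaurentPolynomial.invert P) N where
  two_le := hP.two_le
  coeff_eq_zero k hk := by
    rw [LaurentPolynomial.invert_apply, hP.coeff_eq_zero _ (by rwa [abs_neg])]
  coeff_top_ne_zero := by rw [LaurentPolynomial.invert_apply]; exact hP.coeff_bot_ne_zero
  coeff_bot_ne_zero := by
    rw [LaurentPolynomial.invert_apply, neg_neg]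
    exact hP.coeff_top_ne_zero
  coeff_zero_ne_zero := by
    rw [LaurentPolynomial.invert_apply, neg_zero]
    exact hP.coeff_zero_ne_zero
  three_dvd hN k hk := by
    rw [LaurentPolynomial.invert_apply] at hk
    exact (dvd_neg (α := ℤ)).mp (hP.three_dvd hN _ hk)

theorem le_of_coeff_ne_zero (hP : IsRotorSpectrum P N) {k : ℤ} (hk : P.coeff k ≠ 0) : k ≤ N := by
  contrapose! hk
  exact hP.coeff_eq_zero k (hk.trans_le (le_abs_self k))

theorem hasLeadingTerms_three_curvePlus (hP : IsRotorSpectrum P 3) :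
    HasLeadingTerms 3 (curvePlus P) 4 (.inl (-2 * P.coeff 3) + .inr (P.coeff 0)) := by
  convert HasLeadingTerms.of_coeff (f := curvePlus P) (q := 3) (d := 4) (by norm_num)
    fun k hk => ?_ using 3
  · rw [coeff_curvePlus]
    norm_num
  · rw [coeff_curvePlus]
    norm_num
  · rw [coeff_curvePlus] at hk
    have := hP.le_of_coeff_ne_zero (right_ne_zero_of_mul hk)
    have := hP.three_dvd rfl _ (right_ne_zero_of_mul hk)
    lia

theorem hasLeadingTerms_three_curveMinus (hP : IsRotorSpectrum P 3) :
    HasLeadingTerms 3 (curveMinus P) 2 (.inl (4 * P.coeff 3) + .inr (P.coeff 0)) := by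
  convert HasLeadingTerms.of_coeff (f := curveMinus P) (q := 3) (d := 2) (by norm_num)
    fun k hk => ?_ using 3
  · rw [coeff_curveMinus]
    norm_num
  · rw [coeff_curveMinus]
    norm_num
  · rw [coeff_curveMinus] at hk
    have := hP.le_of_coeff_ne_zero (right_ne_zero_of_mul hk)
    have := hP.three_dvd rfl _ (right_ne_zero_of_mul hk)
    lia

variable [CharZero K]

theorem hasLeadingTerms_curvePlus (hP : IsRotorSpectrum P N) :
    ∃ c : DualNumber K, c.fst ≠ 0 ∧ HasLeadingTerms 1 (curvePlus P) (N + 1) c := by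
  refine ⟨_, ?_, .of_coeff zero_lt_one fun k hk => ?_⟩
  · rw [TrivSqZeroExt.fst_add, TrivSqZeroExt.fst_inl, TrivSqZeroExt.fst_inr, add_zero,
      coeff_curvePlus, add_sub_cancel_right]
    refine mul_ne_zero ?_ hP.coeff_top_ne_zero
    have := hP.two_le
    exact_mod_cast (by lia : 2 - (N + 1) ≠ 0)
  · rw [coeff_curvePlus] at hk
    have := hP.le_of_coeff_ne_zero (right_ne_zero_of_mul hk)
    lia

theorem hasLeadingTerms_curveMinus (hP : IsRotorSpectrum P N) :
    ∃ c : DualNumber K, c.fst ≠ 0 ∧ HasLeadingTerms 1 (curveMinus P) (N - 1) c := by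
  refine ⟨_, ?_, .of_coeff zero_lt_one fun k hk => ?_⟩
  · rw [TrivSqZeroExt.fst_add, TrivSqZeroExt.fst_inl, TrivSqZeroExt.fst_inr, add_zero,
      coeff_curveMinus, sub_add_cancel]
    refine mul_ne_zero ?_ hP.coeff_top_ne_zero
    have := hP.two_le
    exact_mod_cast (by lia : 2 + (N - 1) ≠ 0)
  · rw [coeff_curveMinus] at hk
    have := hP.le_of_coeff_ne_zero (right_ne_zero_of_mul hk)
    lia

variable {F : MvPolynomial (Fin 2) K}

theorem one_lt_card_newtonFace (hP : IsRotorSpectrum P N) (hF₀ : F ≠ 0)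
    (hF : MvPolynomial.aeval ![curvePlus P, curveMinus P] F = 0) :
    1 < (newtonFace F (N + 1) (N - 1)).card := by
  obtain ⟨z, hz, hZ⟩ := hP.hasLeadingTerms_curvePlus
  obtain ⟨w, hw, hW⟩ := hP.hasLeadingTerms_curveMinus
  exact _root_.one_lt_card_newtonFace zero_lt_one hZ hW hz hw hF₀ hF

theorem one_lt_card_newtonFace_swap (hP : IsRotorSpectrum P N) (hF₀ : F ≠ 0)
    (hF : MvPolynomial.aeval ![curvePlus P, curveMinus P] F = 0) :
    1 < (newtonFace F (N - 1) (N + 1)).card := by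
  obtain ⟨z, hz, hZ⟩ := hP.invert.hasLeadingTerms_curvePlus
  obtain ⟨w, hw, hW⟩ := hP.invert.hasLeadingTerms_curveMinus
  refine _root_.one_lt_card_newtonFace zero_lt_one hW hZ hw hz hF₀ ?_
  have hinvert :
      ![curveMinus (LaurentPolynomial.invert P), curvePlus (LaurentPolynomial.invert P)] =
      fun i => AlgHomClass.toAlgHom LaurentPolynomial.invert (![curvePlus P, curveMinus P] i) := by
    funext i
    fin_cases i
    · exact (invert_curvePlus P).symm
    · exact (invert_curveMinus P).symm
  rw [hinvert, ← MvPolynomial.comp_aeval_apply, hF, map_zero]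

theorem six_le_totalDegree (hP : IsRotorSpectrum P N) (hF₀ : F ≠ 0)
    (hF : MvPolynomial.aeval ![curvePlus P, curveMinus P] F = 0) : 6 ≤ F.totalDegree := by
  have hN := hP.two_le
  have hcard := hP.one_lt_card_newtonFace hF₀ hF
  have hcard' := hP.one_lt_card_newtonFace_swap hF₀ hF
  obtain rfl | hN₃ := eq_or_ne N 3
  · obtain ⟨m', hm', hm'₀⟩ : ∃ m ∈ newtonFace F 2 4, 2 ≤ m 0 :=
      exists_mem_newtonFace_le_apply_zero hcard' (by norm_num) fun u v h => ⟨u, by lia⟩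
    exact six_le_totalDegree_of_gap_three hP.coeff_top_ne_zero hP.coeff_zero_ne_zero
      hP.hasLeadingTerms_three_curvePlus hP.hasLeadingTerms_three_curveMinus hF₀ hF fun m hm =>
        hm'₀.trans (apply_zero_le_of_mem_newtonFace_swap (by norm_num) (by norm_num) hm hm')
  · obtain ⟨d, hd, hdvd⟩ := exists_three_le_forall_dvd hN hN₃
    obtain ⟨m, hm, hm₁⟩ := exists_mem_newtonFace_le_apply_one hcard (by lia) hdvd
    obtain ⟨m', hm', hm'₀⟩ := exists_mem_newtonFace_le_apply_zero hcard' (by lia) hdvd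
    have hm₀ := apply_zero_le_of_mem_newtonFace_swap (by lia) (by lia) hm hm'
    have := add_le_totalDegree_of_mem_newtonFace hm
    lia

end IsRotorSpectrum

section PrincipalIdeal

variable {R : Type*} [CommRing R] [IsDomain R] [UniqueFactorizationMonoid R] [IsNoetherianRing R]

theorem exists_irreducible_forall_mem_iff_dvd (hdim : ringKrullDim R ≤ 2) {I J : Ideal R}
    [I.IsPrime] [J.IsPrime] (hI : I ≠ ⊥) (hIJ : I < J) :
    ∃ f, Irreducible f ∧ ∀ g, g ∈ I ↔ f ∣ g := by
  have hlt : I.height < J.height := Ideal.height_strict_mono_of_isPrime hIJ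
  have hle : J.height ≤ 2 := WithBot.coe_le_coe.mp <|
    (Ideal.height_le_ringKrullDim_of_ne_top (Ideal.IsPrime.ne_top ‹_›)).trans hdim
  have hone : I.height = 1 := by
    refine le_antisymm (Order.le_of_lt_add_one (hlt.trans_le ?_))
      (Order.one_le_iff_ne_zero.mpr (Ideal.height_eq_zero_iff_eq_bot.not.mpr hI))
    rwa [one_add_one_eq_two]
  obtain ⟨f, rfl⟩ := UniqueFactorizationMonoid.isPrincipal_of_height_eq_one hone
  have hf₀ : f ≠ 0 := by rintro rfl; simp at hI
  exact ⟨f, ((Ideal.span_singleton_prime hf₀).mp ‹_›).irreducible,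
    fun g => Ideal.mem_span_singleton⟩

end PrincipalIdeal

section TranscendenceDegree

variable {k K : Type*} [Field k] [Field K] [Algebra k K]

theorem trdeg_laurentPolynomial : Algebra.trdeg K K[T;T⁻¹] = 1 := by
  have : IsScalarTower K (Polynomial K) K[T;T⁻¹] := .of_algebraMap_eq fun c => by
    rw [LaurentPolynomial.algebraMap_eq_toLaurent]
    simp
  have : FaithfulSMul (Polynomial K) K[T;T⁻¹] :=
    (faithfulSMul_iff_algebraMap_injective _ _).mpr Polynomial.toLaurent_injective
  have : Algebra.IsAlgebraic (Polynomial K) K[T;T⁻¹] :=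
    IsLocalization.isAlgebraic _ (Submonoid.powers (Polynomial.X : Polynomial K))
  rw [← trdeg_add_eq K (Polynomial K), Polynomial.trdeg_of_isDomain, trdeg_eq_zero, add_zero]

theorem exists_aeval_pair_eq_zero [Algebra.IsAlgebraic k K] (v : Fin 2 → K[T;T⁻¹]) :
    ∃ f : MvPolynomial (Fin 2) k, f ≠ 0 ∧ MvPolynomial.aeval v f = 0 := by
  by_contra! h
  have hind : AlgebraicIndependent k v :=
    algebraicIndependent_iff.mpr fun f hf => by_contra fun hf₀ => h f hf₀ hf
  have := hind.lift_cardinalMk_le_trdeg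
  rw [← trdeg_add_eq k K, trdeg_laurentPolynomial, trdeg_eq_zero] at this
  simp at this

end TranscendenceDegree

section IsotropicCoordinates

theorem totalDegree_aeval_le_of_forall_totalDegree_le_one {σ τ R S : Type*}
    [CommSemiring R] [CommSemiring S] [Algebra R S] (f : MvPolynomial σ R)
    {g : σ → MvPolynomial τ S} (hg : ∀ i, (g i).totalDegree ≤ 1) :
    (MvPolynomial.aeval g f).totalDegree ≤ f.totalDegree := by
  rw [MvPolynomial.aeval_def, MvPolynomial.eval₂_eq]
  refine MvPolynomial.totalDegree_finsetSum_le fun m hm => ?_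
  have hconst : (algebraMap R (MvPolynomial τ S) (f.coeff m)).totalDegree = 0 := by
    rw [IsScalarTower.algebraMap_apply R S (MvPolynomial τ S), MvPolynomial.algebraMap_eq,
      MvPolynomial.totalDegree_C]
  calc (algebraMap R (MvPolynomial τ S) (f.coeff m) * ∏ i ∈ m.support, g i ^ m i).totalDegree
      ≤ (∏ i ∈ m.support, g i ^ m i).totalDegree := by
        simpa only [hconst, zero_add] using
          MvPolynomial.totalDegree_mul (algebraMap R (MvPolynomial τ S) (f.coeff m)) _
    _ ≤ ∑ i ∈ m.support, (g i ^ m i).totalDegree := MvPolynomial.totalDegree_finsetProd _ _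
    _ ≤ ∑ i ∈ m.support, m i := Finset.sum_le_sum fun i _ =>
        (MvPolynomial.totalDegree_pow _ _).trans (by simpa using Nat.mul_le_mul_left (m i) (hg i))
    _ ≤ f.totalDegree := MvPolynomial.le_totalDegree hm

/-- The Cartesian coordinates `x, y` in terms of the isotropic coordinates `x - α + i (y - β)` and
`x - α - i (y - β)` centred at `(α, β)`. -/
noncomputable def isotropicSubst (α β : ℂ) : Fin 2 → MvPolynomial (Fin 2) ℂ :=
  ![MvPolynomial.C (1 / 2) * (MvPolynomial.X 0 + MvPolynomial.X 1) + MvPolynomial.C α,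
    MvPolynomial.C (-Complex.I / 2) * (MvPolynomial.X 0 - MvPolynomial.X 1) + MvPolynomial.C β]

/-- The isotropic coordinates `x - α + i (y - β)` and `x - α - i (y - β)` centred at `(α, β)` in
terms of the Cartesian coordinates `x, y`: the substitution inverse to `isotropicSubst`. -/
noncomputable def isotropicCoords (α β : ℂ) : Fin 2 → MvPolynomial (Fin 2) ℂ :=
  ![(MvPolynomial.X 0 - MvPolynomial.C α) +
      MvPolynomial.C Complex.I * (MvPolynomial.X 1 - MvPolynomial.C β),
    (MvPolynomial.X 0 - MvPolynomial.C α) -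
      MvPolynomial.C Complex.I * (MvPolynomial.X 1 - MvPolynomial.C β)]

/-- The Cartesian coordinates, as Laurent polynomials in `e^{iθ}`, of the curve with support
function `p(θ) = P(e^{iθ})`. -/
noncomputable def planeCoords (P : ℂ[T;T⁻¹]) : Fin 2 → ℂ[T;T⁻¹] :=
  ![LaurentPolynomial.C (1 / 2) * (curvePlus P + curveMinus P),
    LaurentPolynomial.C (-Complex.I / 2) * (curvePlus P - curveMinus P)]

/-- The Laurent polynomial in `e^{iθ}` of the harmonic `a cos jθ + b sin jθ`. -/
noncomputable def laurentHarmonic (j : ℤ) (a b : ℂ) : ℂ[T;T⁻¹] :=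
  LaurentPolynomial.C ((a - b * Complex.I) / 2) * T j +
    LaurentPolynomial.C ((a + b * Complex.I) / 2) * T (-j)

variable (α β : ℂ)

theorem totalDegree_isotropicSubst_le_one (i : Fin 2) :
    (isotropicSubst α β i).totalDegree ≤ 1 := by
  have hlinear (c d : ℂ) {q : MvPolynomial (Fin 2) ℂ} (hq : q.totalDegree ≤ 1) :
      (MvPolynomial.C c * q + MvPolynomial.C d).totalDegree ≤ 1 := by
    refine (MvPolynomial.totalDegree_add _ _).trans (max_le ?_ (by simp))
    exact (MvPolynomial.totalDegree_mul _ _).trans (by simpa using hq)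
  fin_cases i
  · exact hlinear _ _ ((MvPolynomial.totalDegree_add _ _).trans (by simp))
  · exact hlinear _ _ ((MvPolynomial.totalDegree_sub _ _).trans (by simp))

theorem aeval_isotropicCoords_comp_aeval_isotropicSubst :
    ((MvPolynomial.aeval (isotropicCoords α β)).restrictScalars ℝ).comp
      (MvPolynomial.aeval (isotropicSubst α β)) = MvPolynomial.mapAlgHom (Algebra.ofId ℝ ℂ) := by
  have htwo : (MvPolynomial.C (1 / 2) * 2 : MvPolynomial (Fin 2) ℂ) = 1 := by
    rw [← map_ofNat (MvPolynomial.C (σ := Fin 2) (R := ℂ)), ← map_mul]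
    norm_num
  have hI : (MvPolynomial.C (-Complex.I / 2) * MvPolynomial.C Complex.I * 2 :
      MvPolynomial (Fin 2) ℂ) = 1 := by
    rw [← map_ofNat (MvPolynomial.C (σ := Fin 2) (R := ℂ)), ← map_mul, ← map_mul,
      div_mul_eq_mul_div, neg_mul, Complex.I_mul_I]
    norm_num
  refine MvPolynomial.algHom_ext fun i => ?_
  fin_cases i
  · simp only [isotropicSubst, isotropicCoords, Fin.zero_eta, AlgHom.coe_comp,
      AlgHom.coe_restrictScalars', Function.comp_apply, MvPolynomial.aeval_X, MvPolynomial.aeval_C,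
      Matrix.cons_val_zero, Matrix.cons_val_one, map_add, map_mul, MvPolynomial.algebraMap_eq,
      MvPolynomial.mapAlgHom_apply, Algebra.toRingHom_ofId, MvPolynomial.map_X]
    linear_combination (MvPolynomial.X 0 - MvPolynomial.C α) * htwo
  · simp only [isotropicSubst, isotropicCoords, Fin.mk_one, AlgHom.coe_comp,
      AlgHom.coe_restrictScalars', Function.comp_apply, MvPolynomial.aeval_X, MvPolynomial.aeval_C,
      Matrix.cons_val_zero, Matrix.cons_val_one, map_add, map_sub, map_mul,
      MvPolynomial.algebraMap_eq, MvPolynomial.mapAlgHom_apply, Algebra.toRingHom_ofId,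
      MvPolynomial.map_X]
    linear_combination (MvPolynomial.X 1 - MvPolynomial.C β) * hI

theorem aeval_isotropicSubst_injective :
    Function.Injective (MvPolynomial.aeval (R := ℝ) (isotropicSubst α β)) := by
  refine Function.Injective.of_comp
    (f := (MvPolynomial.aeval (R := ℂ) (isotropicCoords α β)).restrictScalars ℝ) ?_
  rw [← AlgHom.coe_comp, aeval_isotropicCoords_comp_aeval_isotropicSubst]
  exact MvPolynomial.map_injective _ (algebraMap ℝ ℂ).injective

theorem curvePlus_add_laurentHarmonic_one (P : ℂ[T;T⁻¹]) :
    curvePlus (P + laurentHarmonic 1 α β) =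
      curvePlus P + LaurentPolynomial.C (α + β * Complex.I) := by
  rw [curvePlus_add, laurentHarmonic, curvePlus_add, curvePlus_C_mul_T, curvePlus_C_mul_T]
  simp only [Int.cast_one, Int.cast_neg, sub_self, zero_mul, map_zero, zero_add, neg_add_cancel,
    LaurentPolynomial.T_zero, mul_one]
  congr 2
  ring

theorem curveMinus_add_laurentHarmonic_one (P : ℂ[T;T⁻¹]) :
    curveMinus (P + laurentHarmonic 1 α β) =
      curveMinus P + LaurentPolynomial.C (α - β * Complex.I) := by
  rw [curveMinus_add, laurentHarmonic, curveMinus_add, curveMinus_C_mul_T, curveMinus_C_mul_T]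
  simp only [Int.cast_one, Int.cast_neg, add_neg_cancel, zero_mul, map_zero, add_zero, sub_self,
    LaurentPolynomial.T_zero, mul_one]
  congr 2
  ring

theorem planeCoords_add_laurentHarmonic_one (P : ℂ[T;T⁻¹]) (i : Fin 2) :
    planeCoords (P + laurentHarmonic 1 α β) i =
      MvPolynomial.aeval ![curvePlus P, curveMinus P] (isotropicSubst α β i) := by
  have hα : (α = 1 / 2 * (α + β * Complex.I + (α - β * Complex.I))) := by ring
  have hβ : (β = -Complex.I / 2 * (α + β * Complex.I - (α - β * Complex.I))) := by
    linear_combination β * Complex.I_mul_I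
  rw [planeCoords, curvePlus_add_laurentHarmonic_one, curveMinus_add_laurentHarmonic_one]
  fin_cases i
  · conv_rhs => rw [hα]
    simp only [isotropicSubst, LaurentPolynomial.algebraMap_apply, Algebra.algebraMap_self,
      RingHom.id_apply, MvPolynomial.aeval_X, MvPolynomial.algHom_C, Matrix.cons_val_zero,
      Matrix.cons_val_one, map_add, map_sub, map_mul, Fin.zero_eta]
    ring
  · conv_rhs => rw [hβ]
    simp only [isotropicSubst, LaurentPolynomial.algebraMap_apply, Algebra.algebraMap_self,
      RingHom.id_apply, MvPolynomial.aeval_X, MvPolynomial.algHom_C, Matrix.cons_val_zero,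
      Matrix.cons_val_one, map_add, map_sub, map_mul, Fin.mk_one]
    ring

variable {α β} {P : ℂ[T;T⁻¹]}

theorem IsRotorSpectrum.six_le_totalDegree_of_aeval_planeCoords_eq_zero {N : ℤ}
    (hP : IsRotorSpectrum P N) {f : MvPolynomial (Fin 2) ℝ} (hf₀ : f ≠ 0)
    (hf : MvPolynomial.aeval (planeCoords (P + laurentHarmonic 1 α β)) f = 0) :
    6 ≤ f.totalDegree := by
  rw [funext (planeCoords_add_laurentHarmonic_one α β P),
    ← AlgHom.coe_restrictScalars' ℝ (MvPolynomial.aeval ![curvePlus P, curveMinus P]),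
    ← MvPolynomial.comp_aeval_apply, AlgHom.coe_restrictScalars'] at hf
  refine (hP.six_le_totalDegree ?_ hf).trans
    (totalDegree_aeval_le_of_forall_totalDegree_le_one f (totalDegree_isotropicSubst_le_one α β))
  exact (map_ne_zero_iff _ (aeval_isotropicSubst_injective α β)).mpr hf₀

end IsotropicCoordinates

section Curve

/-- Evaluation of a Laurent polynomial at the point `e^{iθ}` of the unit circle. -/
noncomputable def evalCircle (θ : ℝ) : ℂ[T;T⁻¹] →ₐ[ℂ] ℂ where
  __ := LaurentPolynomial.eval₂ (RingHom.id ℂ) (Circle.toUnits (Circle.exp θ))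
  commutes' c := LaurentPolynomial.eval₂_C _ _ c

theorem evalCircle_C (θ : ℝ) (c : ℂ) : evalCircle θ (LaurentPolynomial.C c) = c :=
  LaurentPolynomial.eval₂_C _ _ c

theorem evalCircle_T (θ : ℝ) (n : ℤ) :
    evalCircle θ (T n) = Complex.exp (n * (θ * Complex.I)) := by
  refine (LaurentPolynomial.eval₂_T _ _ n).trans ?_
  rw [Units.val_zpow_eq_zpow_val, Circle.toUnits_apply, Units.val_mk0, Circle.coe_exp,
    Complex.exp_int_mul]

theorem eq_zero_of_forall_evalCircle_eq_zero {P : ℂ[T;T⁻¹]}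
    (h : ∀ θ ∈ Set.Icc (-Real.pi) Real.pi, evalCircle θ P = 0) : P = 0 := by
  obtain ⟨n, p, hp⟩ := P.exists_T_pow
  have hroot (z : Circle) : p.IsRoot z := by
    have harg := h _ ⟨(Complex.neg_pi_lt_arg z).le, Complex.arg_le_pi z⟩
    have hmul : evalCircle (Complex.arg z) (Polynomial.toLaurent p) = 0 := by
      rw [hp, map_mul, harg, zero_mul]
    have heval := (LaurentPolynomial.eval₂_toLaurent _ _ p).symm.trans hmul
    rwa [Circle.exp_arg, Circle.toUnits_apply, Units.val_mk0] at heval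
  have : Infinite Circle := Circle.argEquiv.infinite_iff.mpr
    (Set.Ioc_infinite (neg_lt_self Real.pi_pos)).to_subtype
  have hinf : (Set.range fun z : Circle => (z : ℂ)).Infinite :=
    Set.infinite_range_of_injective fun _ _ => Circle.ext
  have hp₀ : p = 0 :=
    Polynomial.eq_zero_of_infinite_isRoot p (hinf.mono (Set.range_subset_iff.mpr hroot))
  rw [hp₀, map_zero] at hp
  exact (LaurentPolynomial.isUnit_T n).mul_left_eq_zero.mp hp.symm

theorem hasDerivAt_evalCircle (P : ℂ[T;T⁻¹]) (θ : ℝ) :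
    HasDerivAt (fun θ => evalCircle θ P) (Complex.I * evalCircle θ (euler P)) θ := by
  induction P using LaurentPolynomial.induction_on' with
  | add P Q hP hQ =>
    simp only [map_add, euler_add, mul_add]
    exact hP.add hQ
  | C_mul_T n c =>
    rw [euler_C_mul_T, map_mul, evalCircle_C, evalCircle_T]
    simp only [map_mul, evalCircle_C, evalCircle_T]
    have hexp := (((hasDerivAt_id θ).ofReal_comp.mul_const Complex.I).const_mul (n : ℂ)).cexp
    refine (hexp.const_mul c).congr_deriv ?_
    simp only [id]
    push_cast
    ring

/-- `P` is the Laurent polynomial in `e^{iθ}` of the real function `p`. -/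
def HasLaurentExpansion (p : ℝ → ℝ) (P : ℂ[T;T⁻¹]) : Prop :=
  ∀ θ, (p θ : ℂ) = evalCircle θ P

namespace HasLaurentExpansion

variable {p : ℝ → ℝ} {P : ℂ[T;T⁻¹]}

theorem hasDerivAt (h : HasLaurentExpansion p P) (θ : ℝ) :
    HasDerivAt p (Complex.I * evalCircle θ (euler P)).re θ := by
  have := Complex.reCLM.hasFDerivAt.comp_hasDerivAt θ (hasDerivAt_evalCircle P θ)
  refine this.congr_of_eventuallyEq (.of_forall fun t => ?_)
  rw [Function.comp_apply, ← h t, Complex.reCLM_apply, Complex.ofReal_re]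

theorem ofReal_deriv (h : HasLaurentExpansion p P) (θ : ℝ) :
    ((deriv p θ : ℝ) : ℂ) = Complex.I * evalCircle θ (euler P) := by
  refine HasDerivAt.unique (f := fun t => (p t : ℂ)) (x := θ)
    (h.hasDerivAt θ).differentiableAt.hasDerivAt.ofReal_comp ?_
  exact (hasDerivAt_evalCircle P θ).congr_of_eventuallyEq (.of_forall h)

theorem ofReal_supportParam (h : HasLaurentExpansion p P) (θ : ℝ) (i : Fin 2) :
    (supportParam p θ i : ℂ) = evalCircle θ (planeCoords P i) := by
  have hexp : Complex.exp (θ * Complex.I) = Complex.cos θ + Complex.sin θ * Complex.I :=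
    Complex.exp_mul_I _
  have hexp' : Complex.exp (-(θ * Complex.I)) = Complex.cos θ - Complex.sin θ * Complex.I := by
    rw [← neg_mul, Complex.exp_mul_I, Complex.cos_neg, Complex.sin_neg, neg_mul, sub_eq_add_neg]
  fin_cases i
  · simp only [supportParam, planeCoords, curvePlus, curveMinus, Fin.zero_eta, Matrix.cons_val_zero,
      Complex.ofReal_sub, Complex.ofReal_mul, Complex.ofReal_cos, Complex.ofReal_sin, h θ,
      h.ofReal_deriv, map_add, map_sub, map_mul, evalCircle_C, evalCircle_T, Int.cast_one,
      Int.cast_neg, one_mul, neg_mul, hexp, hexp']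
    ring
  · simp only [supportParam, planeCoords, curvePlus, curveMinus, Fin.mk_one, Matrix.cons_val_one,
      Matrix.cons_val_fin_one, Complex.ofReal_add, Complex.ofReal_mul, Complex.ofReal_cos,
      Complex.ofReal_sin, h θ, h.ofReal_deriv, map_add, map_sub, map_mul, evalCircle_C,
      evalCircle_T, Int.cast_one, Int.cast_neg, one_mul, neg_mul, hexp, hexp']
    linear_combination (evalCircle θ P * Complex.sin θ) * Complex.I_mul_I

theorem ofReal_eval_supportParam (h : HasLaurentExpansion p P) (f : MvPolynomial (Fin 2) ℝ)
    (θ : ℝ) :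
    (MvPolynomial.eval (fun i => supportParam p θ i) f : ℂ) =
      evalCircle θ (MvPolynomial.aeval (planeCoords P) f) := by
  rw [← AlgHom.coe_restrictScalars' ℝ (evalCircle θ), MvPolynomial.comp_aeval_apply]
  simp only [AlgHom.coe_restrictScalars', ← h.ofReal_supportParam]
  exact (MvPolynomial.aeval_algebraMap_apply ℂ (fun i => supportParam p θ i) f).symm

theorem forall_mem_supportCurve_eval_eq_zero_iff (h : HasLaurentExpansion p P)
    (f : MvPolynomial (Fin 2) ℝ) :
    (∀ z ∈ supportCurve p, MvPolynomial.eval (fun i => z i) f = 0) ↔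
      MvPolynomial.aeval (planeCoords P) f = 0 := by
  simp only [supportCurve, Set.forall_mem_image]
  refine ⟨fun hf => eq_zero_of_forall_evalCircle_eq_zero fun θ hθ => ?_, fun hf θ _ => ?_⟩
  · rw [← h.ofReal_eval_supportParam, hf hθ, Complex.ofReal_zero]
  · rw [← Complex.ofReal_eq_zero, h.ofReal_eval_supportParam, hf, map_zero]

end HasLaurentExpansion

end Curve

section DefiningPolynomial

theorem HasLaurentExpansion.exists_isDefiningPolynomial {p : ℝ → ℝ} {P : ℂ[T;T⁻¹]}
    (h : HasLaurentExpansion p P) (hp : (supportCurve p).Nontrivial) :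
    ∃ f, IsDefiningPolynomial f (supportCurve p) := by
  obtain ⟨z, hz, w, hw, hzw⟩ := hp
  let vanishing := RingHom.ker (MvPolynomial.aeval (R := ℝ) (planeCoords P))
  let vanishingAt := RingHom.ker (MvPolynomial.eval fun i => z i)
  have hmem (f : MvPolynomial (Fin 2) ℝ) :
      f ∈ vanishing ↔ ∀ z ∈ supportCurve p, MvPolynomial.eval (fun i => z i) f = 0 :=
    (h.forall_mem_supportCurve_eval_eq_zero_iff f).symm
  have hbot : vanishing ≠ ⊥ := by
    obtain ⟨f, hf₀, hf⟩ := exists_aeval_pair_eq_zero (k := ℝ) (planeCoords P)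
    exact fun hker => hf₀ (Ideal.mem_bot.mp (hker ▸ hf))
  have hlt : vanishing < vanishingAt := by
    refine lt_of_le_not_ge (fun f hf => (hmem f).mp hf z hz) fun hle => hzw ?_
    ext i
    have hi : MvPolynomial.X i - MvPolynomial.C (z i) ∈ vanishingAt := by
      simp [vanishingAt, RingHom.mem_ker]
    simpa [sub_eq_zero, eq_comm (a := z i)] using (hmem _).mp (hle hi) w hw
  have hdim : ringKrullDim (MvPolynomial (Fin 2) ℝ) ≤ 2 := by
    simp [MvPolynomial.ringKrullDim_of_isNoetherianRing]
  have : vanishing.IsPrime := RingHom.ker_isPrime _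
  have : vanishingAt.IsPrime := RingHom.ker_isPrime _
  obtain ⟨f, hf, hdvd⟩ := exists_irreducible_forall_mem_iff_dvd hdim hbot hlt
  exact ⟨f, hf, fun g => (hmem g).symm.trans (hdvd g)⟩

theorem mem_sphere_iff_of_nonneg {c z : Plane} {r : ℝ} (hr : 0 ≤ r) :
    z ∈ Metric.sphere c r ↔ (z 0 - c 0) ^ 2 + (z 1 - c 1) ^ 2 = r ^ 2 := by
  rw [Metric.mem_sphere, EuclideanSpace.dist_eq, Fin.sum_univ_two, Real.dist_eq, Real.dist_eq,
    sq_abs, sq_abs, Real.sqrt_eq_iff_eq_sq (by positivity) hr]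

/-- The equation of the circle with centre `c` and squared radius `d`. -/
noncomputable def circlePoly (c : Plane) (d : ℝ) : MvPolynomial (Fin 2) ℝ :=
  (MvPolynomial.X 0 - MvPolynomial.C (c 0)) ^ 2 + (MvPolynomial.X 1 - MvPolynomial.C (c 1)) ^ 2 -
    MvPolynomial.C d

theorem eval_circlePoly (c z : Plane) (d : ℝ) :
    MvPolynomial.eval (fun i => z i) (circlePoly c d) =
      (z 0 - c 0) ^ 2 + (z 1 - c 1) ^ 2 - d := by
  simp [circlePoly]

theorem circlePoly_ne_zero (c : Plane) (d : ℝ) : circlePoly c d ≠ 0 := by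
  intro h
  have h₀ := eval_circlePoly c c d
  have h₁ := eval_circlePoly c !₂[c 0 + 1, c 1] d
  simp only [h, map_zero] at h₀ h₁
  simp at h₀ h₁
  linarith

theorem totalDegree_circlePoly_le (c : Plane) (d : ℝ) : (circlePoly c d).totalDegree ≤ 2 := by
  have hsq (i : Fin 2) :
      ((MvPolynomial.X i - MvPolynomial.C (c i)) ^ 2 : MvPolynomial (Fin 2) ℝ).totalDegree ≤ 2 :=
    (MvPolynomial.totalDegree_pow _ _).trans <| Nat.mul_le_mul_left 2 <|
      (MvPolynomial.totalDegree_sub_C_le _ _).trans (MvPolynomial.totalDegree_X _).le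
  exact (MvPolynomial.totalDegree_sub_C_le _ _).trans <|
    (MvPolynomial.totalDegree_add _ _).trans (max_le (hsq 0) (hsq 1))

variable {p : ℝ → ℝ} {P : ℂ[T;T⁻¹]} {N : ℤ} {α β : ℂ}

namespace IsRotorSpectrum

theorem six_le_totalDegree_of_vanishing (hP : IsRotorSpectrum P N)
    (h : HasLaurentExpansion p (P + laurentHarmonic 1 α β)) {f : MvPolynomial (Fin 2) ℝ}
    (hf₀ : f ≠ 0) (hf : ∀ z ∈ supportCurve p, MvPolynomial.eval (fun i => z i) f = 0) :
    6 ≤ f.totalDegree :=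
  hP.six_le_totalDegree_of_aeval_planeCoords_eq_zero hf₀
    ((h.forall_mem_supportCurve_eval_eq_zero_iff f).mp hf)

theorem not_isCircle (hP : IsRotorSpectrum P N)
    (h : HasLaurentExpansion p (P + laurentHarmonic 1 α β)) : ¬ IsCircle (supportCurve p) := by
  rintro ⟨c, r, hr, hC⟩
  have := hP.six_le_totalDegree_of_vanishing h (circlePoly_ne_zero c (r ^ 2)) fun z hz => by
    rw [eval_circlePoly, (mem_sphere_iff_of_nonneg hr.le).mp (hC ▸ hz), sub_self]
  have := totalDegree_circlePoly_le c (r ^ 2)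
  lia

theorem nontrivial_supportCurve (hP : IsRotorSpectrum P N)
    (h : HasLaurentExpansion p (P + laurentHarmonic 1 α β)) : (supportCurve p).Nontrivial := by
  rw [← Set.not_subsingleton_iff]
  intro hsub
  have hne : (supportCurve p).Nonempty :=
    (Set.nonempty_Icc.mpr (neg_lt_self Real.pi_pos).le).image _
  obtain ⟨c, hc⟩ := hne
  have := hP.six_le_totalDegree_of_vanishing h (circlePoly_ne_zero c 0) fun z hz => by
    rw [eval_circlePoly, hsub hz hc]
    ring
  have := totalDegree_circlePoly_le c 0
  lia

theorem exists_isDefiningPolynomial (hP : IsRotorSpectrum P N)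
    (h : HasLaurentExpansion p (P + laurentHarmonic 1 α β)) :
    ∃ f, IsDefiningPolynomial f (supportCurve p) :=
  h.exists_isDefiningPolynomial (hP.nontrivial_supportCurve h)

theorem six_le_totalDegree_of_isDefiningPolynomial (hP : IsRotorSpectrum P N)
    (h : HasLaurentExpansion p (P + laurentHarmonic 1 α β)) {f : MvPolynomial (Fin 2) ℝ}
    (hf : IsDefiningPolynomial f (supportCurve p)) : 6 ≤ f.totalDegree :=
  hP.six_le_totalDegree_of_vanishing h hf.1.ne_zero ((hf.2 f).mpr dvd_rfl)

end IsRotorSpectrum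

end DefiningPolynomial

section Rotors

theorem coeff_laurentHarmonic (j : ℤ) (a b : ℂ) (k : ℤ) :
    (laurentHarmonic j a b).coeff k = (if j = k then (a - b * Complex.I) / 2 else 0) +
      if -j = k then (a + b * Complex.I) / 2 else 0 := by
  rw [laurentHarmonic, AddMonoidAlgebra.coeff_add, Finsupp.add_apply, coeff_C_mul_T, coeff_C_mul_T]

theorem coeff_neg_laurentHarmonic (j : ℤ) (a b : ℝ) (k : ℤ) :
    (laurentHarmonic j a b).coeff (-k) = star ((laurentHarmonic j a b).coeff k) := by
  have hstar : star (((a : ℂ) - b * Complex.I) / 2) = (a + b * Complex.I) / 2 := by simp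
  rw [coeff_laurentHarmonic, coeff_laurentHarmonic, star_add, apply_ite star, apply_ite star, hstar,
    ← hstar, star_star, star_zero, add_comm]
  simp only [neg_eq_iff_eq_neg, neg_neg]

theorem evalCircle_laurentHarmonic (θ : ℝ) (j : ℤ) (a b : ℂ) :
    evalCircle θ (laurentHarmonic j a b) =
      a * Complex.cos (j * θ) + b * Complex.sin (j * θ) := by
  have hexp : Complex.exp (j * (θ * Complex.I)) =
      Complex.cos (j * θ) + Complex.sin (j * θ) * Complex.I := by
    rw [← mul_assoc, Complex.exp_mul_I]
  have hexp' : Complex.exp (-j * (θ * Complex.I)) =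
      Complex.cos (j * θ) - Complex.sin (j * θ) * Complex.I := by
    rw [← mul_assoc, Complex.exp_mul_I, neg_mul, Complex.cos_neg, Complex.sin_neg, neg_mul,
      sub_eq_add_neg]
  rw [laurentHarmonic, map_add, map_mul, map_mul, evalCircle_C, evalCircle_C, evalCircle_T,
    evalCircle_T, Int.cast_neg, hexp, hexp']
  linear_combination -b * Complex.sin (j * θ) * Complex.I_mul_I

/-- The Laurent polynomial in `e^{iθ}` of the support function of a rotor of a regular `n`-gon,
without its harmonics of order one, which merely translate the rotor. -/
noncomputable def rotorLaurent (n : ℕ) (ρ : ℝ) (m : ℕ) (a b : ℤ → ℝ) : ℂ[T;T⁻¹] :=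
  LaurentPolynomial.C (ρ : ℂ) + ∑ k ∈ Finset.range m,
    (laurentHarmonic ((k + 1 : ℕ) * n + 1) (a ((k + 1 : ℕ) * n + 1)) (b ((k + 1 : ℕ) * n + 1)) +
      laurentHarmonic ((k + 1 : ℕ) * n - 1) (a ((k + 1 : ℕ) * n - 1)) (b ((k + 1 : ℕ) * n - 1)))

variable {n : ℕ} {ρ : ℝ} {m : ℕ} {a b : ℤ → ℝ}

theorem hasLaurentExpansion_rotorSupport :
    HasLaurentExpansion (rotorSupport n ρ m a b)
      (rotorLaurent n ρ m a b +
        laurentHarmonic 1 (a 1 + a (-1) : ℝ) (b 1 - b (-1) : ℝ)) := by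
  intro θ
  rw [rotorSupport, Finset.sum_range_succ', rotorLaurent]
  simp only [map_add, map_sum, evalCircle_C, evalCircle_laurentHarmonic]
  push_cast
  simp only [zero_mul, zero_add, zero_sub, one_mul, neg_mul, Complex.cos_neg, Complex.sin_neg,
    ← add_assoc]
  ring

theorem coeff_rotorLaurent (k : ℤ) :
    (rotorLaurent n ρ m a b).coeff k = (if k = 0 then (ρ : ℂ) else 0) +
      ∑ i ∈ Finset.range m,
        ((laurentHarmonic ((i + 1 : ℕ) * n + 1) (a ((i + 1 : ℕ) * n + 1))
            (b ((i + 1 : ℕ) * n + 1))).coeff k +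
          (laurentHarmonic ((i + 1 : ℕ) * n - 1) (a ((i + 1 : ℕ) * n - 1))
            (b ((i + 1 : ℕ) * n - 1))).coeff k) := by
  simp only [rotorLaurent, AddMonoidAlgebra.coeff_add, AddMonoidAlgebra.coeff_sum,
    Finsupp.add_apply, Finsupp.finsetSum_apply, LaurentPolynomial.C_apply]

theorem coeff_neg_rotorLaurent (k : ℤ) :
    (rotorLaurent n ρ m a b).coeff (-k) = star ((rotorLaurent n ρ m a b).coeff k) := by
  simp only [coeff_rotorLaurent, coeff_neg_laurentHarmonic, star_add, star_sum, apply_ite star,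
    star_zero, neg_eq_zero, Complex.star_def, Complex.conj_ofReal]

theorem eq_or_eq_neg_of_coeff_laurentHarmonic_ne_zero {j k : ℤ} {c d : ℂ}
    (h : (laurentHarmonic j c d).coeff k ≠ 0) : k = j ∨ k = -j := by
  rw [coeff_laurentHarmonic] at h
  by_contra! hk
  simp [hk.1.symm, hk.2.symm] at h

theorem of_coeff_rotorLaurent_ne_zero {k : ℤ} (hk : k ≠ 0)
    (h : (rotorLaurent n ρ m a b).coeff k ≠ 0) :
    n - 1 ≤ |k| ∧ ((n : ℤ) ∣ k - 1 ∨ (n : ℤ) ∣ k + 1) := by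
  rw [coeff_rotorLaurent, if_neg hk, zero_add] at h
  obtain ⟨i, -, hi⟩ := Finset.exists_ne_zero_of_sum_ne_zero h
  have hle : (n : ℤ) ≤ (i + 1 : ℕ) * n := le_mul_of_one_le_left (by positivity) (by simp)
  have hdvd : (n : ℤ) ∣ (i + 1 : ℕ) * n := dvd_mul_left _ _
  generalize ((i + 1 : ℕ) : ℤ) * n = l at hi hle hdvd
  have hcases : (k = l + 1 ∨ k = -(l + 1)) ∨ k = l - 1 ∨ k = -(l - 1) := by
    by_contra! hne
    refine hi ?_
    rw [not_imp_comm.mp eq_or_eq_neg_of_coeff_laurentHarmonic_ne_zero (by tauto),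
      not_imp_comm.mp eq_or_eq_neg_of_coeff_laurentHarmonic_ne_zero (by tauto), add_zero]
  refine ⟨le_abs.mpr (by lia), ?_⟩
  rcases hcases with (rfl | rfl) | rfl | rfl
  · exact .inl (by simpa using hdvd)
  · exact .inr (by simpa using hdvd)
  · exact .inr (by simpa using hdvd)
  · exact .inl (by simpa [sub_eq_add_neg] using hdvd)

theorem coeff_zero_rotorLaurent (hn : 2 ≤ n) : (rotorLaurent n ρ m a b).coeff 0 = ρ := by
  rw [coeff_rotorLaurent, if_pos rfl, add_eq_left]
  refine Finset.sum_eq_zero fun i _ => ?_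
  have : (n : ℤ) ≤ (i + 1 : ℕ) * n := le_mul_of_one_le_left (by positivity) (by simp)
  have hzero {j : ℤ} {c d : ℂ} (hj : j ≠ 0) : (laurentHarmonic j c d).coeff 0 = 0 := by
    simp only [coeff_laurentHarmonic, neg_eq_zero, if_neg hj, add_zero]
  rw [hzero (by lia), hzero (by lia), add_zero]

theorem isRotorSpectrum_rotorLaurent (hn : 3 ≤ n) (hρ : ρ ≠ 0) {k : ℤ} (hk₀ : k ≠ 0)
    (hk : (rotorLaurent n ρ m a b).coeff k ≠ 0)
    (hmax : ∀ j, (rotorLaurent n ρ m a b).coeff j ≠ 0 → |j| ≤ |k|) :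
    IsRotorSpectrum (rotorLaurent n ρ m a b) |k| := by
  have hneg : (rotorLaurent n ρ m a b).coeff (-k) ≠ 0 := by
    rwa [coeff_neg_rotorLaurent, star_ne_zero]
  have ⟨hle, hdvd⟩ := of_coeff_rotorLaurent_ne_zero hk₀ hk
  refine ⟨by lia, fun j hj => by_contra fun h => (hmax j h).not_gt hj, ?_, ?_, ?_, ?_⟩
  · rcases abs_choice k with h | h <;> rwa [h]
  · rcases abs_choice k with h | h <;> rw [h]
    · exact hneg
    · rwa [neg_neg]
  · rw [coeff_zero_rotorLaurent (by lia)]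
    exact Complex.ofReal_ne_zero.mpr hρ
  · intro h₃ j hj
    have hk₃ := (abs_eq zero_le_three).mp h₃
    have hn₄ : n = 4 := by
      have : n ≤ 4 := by lia
      interval_cases n <;> lia
    subst hn₄
    obtain rfl | hj₀ := eq_or_ne j 0
    · exact dvd_zero 3
    · have hj₃ : |j| = 3 :=
        le_antisymm (h₃ ▸ hmax j hj) (of_coeff_rotorLaurent_ne_zero hj₀ hj).1
      exact (dvd_abs 3 j).mp hj₃.symm.dvd

theorem rotorLaurent_eq_C_or_isRotorSpectrum (hn : 3 ≤ n) (hρ : ρ ≠ 0) :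
    rotorLaurent n ρ m a b = LaurentPolynomial.C (ρ : ℂ) ∨
      ∃ N, IsRotorSpectrum (rotorLaurent n ρ m a b) N := by
  by_cases hconst : ∀ k ≠ 0, (rotorLaurent n ρ m a b).coeff k = 0
  · refine .inl (LaurentPolynomial.ext fun k => ?_)
    rw [LaurentPolynomial.C_apply]
    split_ifs with hk
    · rw [hk, coeff_zero_rotorLaurent (by lia)]
    · exact hconst k hk
  · push Not at hconst
    obtain ⟨j, hj₀, hj⟩ := hconst
    obtain ⟨k, hk, hmax⟩ := (rotorLaurent n ρ m a b).coeff.support.exists_max_image abs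
      ⟨j, Finsupp.mem_support_iff.mpr hj⟩
    simp only [Finsupp.mem_support_iff] at hk hmax
    have hk₀ : k ≠ 0 := abs_pos.mp ((abs_pos.mpr hj₀).trans_le (hmax j hj))
    exact .inr ⟨_, isRotorSpectrum_rotorLaurent hn hρ hk₀ hk hmax⟩

end Rotors

section CircularRotors

variable {ρ α β : ℝ}

theorem supportParam_const_add_harmonic_one (θ : ℝ) :
    supportParam (fun θ => ρ + (α * Real.cos θ + β * Real.sin θ)) θ =
      !₂[α + ρ * Real.cos θ, β + ρ * Real.sin θ] := by
  have hderiv : deriv (fun θ => ρ + (α * Real.cos θ + β * Real.sin θ)) θ =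
      α * -Real.sin θ + β * Real.cos θ :=
    ((((Real.hasDerivAt_cos θ).const_mul α).add
      ((Real.hasDerivAt_sin θ).const_mul β)).const_add ρ).deriv
  rw [supportParam, hderiv]
  congr 3
  · linear_combination α * Real.sin_sq_add_cos_sq θ
  · linear_combination β * Real.sin_sq_add_cos_sq θ

theorem supportCurve_const_add_harmonic_one (hρ : 0 ≤ ρ) :
    supportCurve (fun θ => ρ + (α * Real.cos θ + β * Real.sin θ)) =
      Metric.sphere !₂[α, β] ρ := by
  refine Set.ext fun z => ⟨?_, fun hz => ?_⟩
  · rintro ⟨θ, -, rfl⟩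
    rw [supportParam_const_add_harmonic_one, mem_sphere_iff_of_nonneg hρ]
    simp only [Matrix.cons_val_zero, Matrix.cons_val_one, Matrix.cons_val_fin_one,
      add_sub_cancel_left]
    linear_combination ρ ^ 2 * Real.sin_sq_add_cos_sq θ
  · rw [mem_sphere_iff_of_nonneg hρ] at hz
    let w : ℂ := ⟨z 0 - α, z 1 - β⟩
    have hw : ‖w‖ = ρ := by
      rw [Complex.norm_def, Complex.normSq_mk, ← sq, ← sq]
      exact (congrArg Real.sqrt hz).trans (Real.sqrt_sq hρ)
    refine ⟨Complex.arg w, ⟨(Complex.neg_pi_lt_arg w).le, Complex.arg_le_pi w⟩, ?_⟩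
    rw [supportParam_const_add_harmonic_one, ← hw, Complex.norm_mul_cos_arg,
      Complex.norm_mul_sin_arg]
    ext i
    fin_cases i
    · exact add_sub_cancel α (z 0)
    · exact add_sub_cancel β (z 1)

theorem HasLaurentExpansion.isCircle_supportCurve {p : ℝ → ℝ} (hρ : 0 < ρ)
    (h : HasLaurentExpansion p (LaurentPolynomial.C (ρ : ℂ) + laurentHarmonic 1 α β)) :
    IsCircle (supportCurve p) := by
  have hp : p = fun θ => ρ + (α * Real.cos θ + β * Real.sin θ) := by
    funext θ
    refine Complex.ofReal_injective ((h θ).trans ?_)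
    rw [map_add, evalCircle_C, evalCircle_laurentHarmonic]
    push_cast
    rw [one_mul]
  rw [hp, supportCurve_const_add_harmonic_one hρ.le]
  exact ⟨_, _, hρ, rfl⟩

theorem exists_isRotorSpectrum_of_mem_algebraicRotors {C : Set Plane}
    (hC : C ∈ algebraicRotors) (hcircle : ¬ IsCircle C) :
    ∃ (p : ℝ → ℝ) (P : ℂ[T;T⁻¹]) (N : ℤ) (α β : ℝ), C = supportCurve p ∧
      IsRotorSpectrum P N ∧ HasLaurentExpansion p (P + laurentHarmonic 1 α β) := by
  obtain ⟨n, ρ, hn, hρ, m, a, b, -, rfl⟩ := hC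
  have hexpansion := hasLaurentExpansion_rotorSupport (n := n) (ρ := ρ) (m := m) (a := a) (b := b)
  obtain hconst | ⟨N, hN⟩ := rotorLaurent_eq_C_or_isRotorSpectrum (a := a) (b := b) hn hρ.ne'
  · rw [hconst] at hexpansion
    exact absurd (hexpansion.isCircle_supportCurve hρ) hcircle
  · exact ⟨_, _, N, _, _, rfl, hN, hexpansion⟩

end CircularRotors

section QuadraticSupport

variable {a₁ b₁ a₂ b₂ : ℝ}

theorem hasDerivAt_quadraticSupport (θ : ℝ) :
    HasDerivAt (quadraticSupport a₁ b₁ a₂ b₂) (-a₁ * Real.sin θ + b₁ * Real.cos θ -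
      2 * a₂ * Real.sin (2 * θ) + 2 * b₂ * Real.cos (2 * θ)) θ := by
  have hid := (hasDerivAt_id θ).const_mul 2
  have h := ((((Real.hasDerivAt_cos θ).const_mul a₁).const_add (1 / 2)).add
    ((Real.hasDerivAt_sin θ).const_mul b₁)).add (hid.cos.const_mul a₂) |>.add
    (hid.sin.const_mul b₂)
  refine h.congr_deriv ?_
  simp only [id]
  ring

theorem deriv_deriv_quadraticSupport (θ : ℝ) :
    deriv (deriv (quadraticSupport a₁ b₁ a₂ b₂)) θ = -a₁ * Real.cos θ - b₁ * Real.sin θ -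
      4 * a₂ * Real.cos (2 * θ) - 4 * b₂ * Real.sin (2 * θ) := by
  have hderiv : deriv (quadraticSupport a₁ b₁ a₂ b₂) = fun θ => -a₁ * Real.sin θ +
      b₁ * Real.cos θ - 2 * a₂ * Real.sin (2 * θ) + 2 * b₂ * Real.cos (2 * θ) :=
    funext fun θ => (hasDerivAt_quadraticSupport θ).deriv
  have hid := (hasDerivAt_id θ).const_mul 2
  have h := (((Real.hasDerivAt_sin θ).const_mul (-a₁)).add
    ((Real.hasDerivAt_cos θ).const_mul b₁)).sub (hid.sin.const_mul (2 * a₂)) |>.add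
    (hid.cos.const_mul (2 * b₂))
  rw [hderiv]
  refine (h.congr_deriv ?_).deriv
  simp only [id]
  ring

theorem convexityConstraint_quadraticSupport (h : |a₂| + |b₂| ≤ 1 / 6) :
    ConvexityConstraint (quadraticSupport a₁ b₁ a₂ b₂) := by
  intro θ
  have hcos : a₂ * Real.cos (2 * θ) ≤ |a₂| :=
    (le_abs_self _).trans <| (abs_mul _ _).trans_le <|
      mul_le_of_le_one_right (abs_nonneg _) (Real.abs_cos_le_one _)
  have hsin : b₂ * Real.sin (2 * θ) ≤ |b₂| :=
    (le_abs_self _).trans <| (abs_mul _ _).trans_le <|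
      mul_le_of_le_one_right (abs_nonneg _) (Real.abs_sin_le_one _)
  rw [deriv_deriv_quadraticSupport, quadraticSupport]
  linarith

theorem quadraticSupport_eq_rotorSupport :
    quadraticSupport a₁ b₁ a₂ b₂ = rotorSupport 3 (1 / 2) 1
      (fun j => if j = 1 then a₁ else if j = 2 then a₂ else 0)
      (fun j => if j = 1 then b₁ else if j = 2 then b₂ else 0) := by
  funext θ
  rw [rotorSupport, Finset.sum_range_succ, Finset.sum_range_one, quadraticSupport]
  norm_num
  ring

theorem isAlgebraicRotor_quadraticSupport
    (hconv : ConvexityConstraint (quadraticSupport a₁ b₁ a₂ b₂)) :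
    IsAlgebraicRotor 3 (1 / 2) (supportCurve (quadraticSupport a₁ b₁ a₂ b₂)) := by
  rw [quadraticSupport_eq_rotorSupport] at hconv ⊢
  exact ⟨le_rfl, one_half_pos, 1, _, _, hconv, rfl⟩

theorem hasLaurentExpansion_quadraticSupport :
    HasLaurentExpansion (quadraticSupport a₁ b₁ a₂ b₂)
      (LaurentPolynomial.C (1 / 2) + laurentHarmonic 2 a₂ b₂ + laurentHarmonic 1 a₁ b₁) := by
  intro θ
  rw [quadraticSupport, map_add, map_add, evalCircle_C, evalCircle_laurentHarmonic,
    evalCircle_laurentHarmonic]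
  push_cast
  rw [one_mul]
  ring

theorem isRotorSpectrum_const_add_laurentHarmonic_two (h : a₂ ≠ 0 ∨ b₂ ≠ 0) :
    IsRotorSpectrum (LaurentPolynomial.C (1 / 2) + laurentHarmonic 2 a₂ b₂) 2 := by
  have hcoeff (k : ℤ) : (LaurentPolynomial.C (1 / 2) + laurentHarmonic 2 a₂ b₂).coeff k =
      (if k = 0 then 1 / 2 else 0) + (laurentHarmonic 2 a₂ b₂).coeff k := by
    rw [AddMonoidAlgebra.coeff_add, Finsupp.add_apply, LaurentPolynomial.C_apply]
  have htop : (LaurentPolynomial.C (1 / 2) + laurentHarmonic 2 a₂ b₂).coeff 2 ≠ 0 := by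
    rw [hcoeff, coeff_laurentHarmonic]
    simpa [Complex.ext_iff, imp_iff_not_or] using h
  refine ⟨le_rfl, fun k hk => ?_, htop, ?_, ?_, by norm_num⟩
  · rw [hcoeff, coeff_laurentHarmonic, if_neg, if_neg, if_neg, add_zero, add_zero] <;>
    · rintro rfl
      norm_num at hk
  · rw [hcoeff, if_neg (by norm_num), zero_add] at htop ⊢
    rwa [coeff_neg_laurentHarmonic, star_ne_zero]
  · rw [hcoeff, coeff_laurentHarmonic]
    norm_num

end QuadraticSupport

section Sextic

variable {a₁ b₁ a₂ b₂ : ℝ}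

theorem supportParam_quadraticSupport {θ u v : ℝ}
    (hu : u = a₂ * Real.cos (2 * θ) + b₂ * Real.sin (2 * θ))
    (hv : v = b₂ * Real.cos (2 * θ) - a₂ * Real.sin (2 * θ)) :
    supportParam (quadraticSupport a₁ b₁ a₂ b₂) θ =
      !₂[a₁ + ((1 / 2 + u) * Real.cos θ - 2 * v * Real.sin θ),
        b₁ + ((1 / 2 + u) * Real.sin θ + 2 * v * Real.cos θ)] := by
  rw [supportParam, (hasDerivAt_quadraticSupport θ).deriv, quadraticSupport, hu, hv]
  congr 3
  · linear_combination a₁ * Real.sin_sq_add_cos_sq θ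
  · linear_combination b₁ * Real.sin_sq_add_cos_sq θ

/-- The quadratic form `a₂ (X² - Y²) + 2 b₂ X Y - 2 (a₂² + b₂²)` in the centred coordinates
`X = x - a₁`, `Y = y - b₁`; along the curve of `quadraticSupport` it is a cubic polynomial in
`a₂ cos 2θ + b₂ sin 2θ`, as `circlePoly` is a quadratic one. -/
noncomputable def secondHarmonicPoly (a₁ b₁ a₂ b₂ : ℝ) : MvPolynomial (Fin 2) ℝ :=
  a₂ • ((MvPolynomial.X 0 - MvPolynomial.C a₁) ^ 2 - (MvPolynomial.X 1 - MvPolynomial.C b₁) ^ 2) +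
    (2 * b₂) • ((MvPolynomial.X 0 - MvPolynomial.C a₁) * (MvPolynomial.X 1 - MvPolynomial.C b₁)) -
    MvPolynomial.C (2 * (a₂ ^ 2 + b₂ ^ 2))

theorem eval_secondHarmonicPoly (z : Plane) :
    MvPolynomial.eval (fun i => z i) (secondHarmonicPoly a₁ b₁ a₂ b₂) =
      a₂ * ((z 0 - a₁) ^ 2 - (z 1 - b₁) ^ 2) + 2 * b₂ * ((z 0 - a₁) * (z 1 - b₁)) -
        2 * (a₂ ^ 2 + b₂ ^ 2) := by
  simp [secondHarmonicPoly]

theorem totalDegree_secondHarmonicPoly_le :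
    (secondHarmonicPoly a₁ b₁ a₂ b₂).totalDegree ≤ 2 := by
  have hX (i : Fin 2) (c : ℝ) : (MvPolynomial.X i - MvPolynomial.C c).totalDegree ≤ 1 :=
    (MvPolynomial.totalDegree_sub_C_le _ _).trans (MvPolynomial.totalDegree_X _).le
  have hsq (i : Fin 2) (c : ℝ) : ((MvPolynomial.X i - MvPolynomial.C c) ^ 2).totalDegree ≤ 2 :=
    (MvPolynomial.totalDegree_pow _ _).trans (Nat.mul_le_mul_left 2 (hX i c))
  exact (MvPolynomial.totalDegree_sub_C_le _ _).trans <|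
    (MvPolynomial.totalDegree_add _ _).trans <| max_le
      ((MvPolynomial.totalDegree_smul_le _ _).trans <|
        (MvPolynomial.totalDegree_sub _ _).trans (max_le (hsq 0 a₁) (hsq 1 b₁)))
      ((MvPolynomial.totalDegree_smul_le _ _).trans <|
        (MvPolynomial.totalDegree_mul _ _).trans (add_le_add (hX 0 a₁) (hX 1 b₁)))

theorem sq_add_sq_eq_of_eq_cos_sin {φ u v : ℝ} (hu : u = a₂ * Real.cos φ + b₂ * Real.sin φ)
    (hv : v = b₂ * Real.cos φ - a₂ * Real.sin φ) : u ^ 2 + v ^ 2 = a₂ ^ 2 + b₂ ^ 2 := by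
  rw [hu, hv]
  linear_combination (a₂ ^ 2 + b₂ ^ 2) * Real.sin_sq_add_cos_sq φ

theorem eval_supportParam_circlePoly {θ u : ℝ}
    (hu : u = a₂ * Real.cos (2 * θ) + b₂ * Real.sin (2 * θ)) :
    MvPolynomial.eval (fun i => supportParam (quadraticSupport a₁ b₁ a₂ b₂) θ i)
      (circlePoly !₂[a₁, b₁] (4 * (a₂ ^ 2 + b₂ ^ 2))) = (1 / 2 + u) ^ 2 - 4 * u ^ 2 := by
  obtain ⟨v, hv⟩ : ∃ v, v = b₂ * Real.cos (2 * θ) - a₂ * Real.sin (2 * θ) := ⟨_, rfl⟩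
  have huv := sq_add_sq_eq_of_eq_cos_sin hu hv
  rw [eval_circlePoly, supportParam_quadraticSupport hu hv]
  simp only [Matrix.cons_val_zero, Matrix.cons_val_one, Matrix.cons_val_fin_one,
    add_sub_cancel_left]
  linear_combination ((1 / 2 + u) ^ 2 + 4 * v ^ 2) * Real.sin_sq_add_cos_sq θ + 4 * huv

theorem eval_supportParam_secondHarmonicPoly {θ u : ℝ}
    (hu : u = a₂ * Real.cos (2 * θ) + b₂ * Real.sin (2 * θ)) :
    MvPolynomial.eval (fun i => supportParam (quadraticSupport a₁ b₁ a₂ b₂) θ i)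
      (secondHarmonicPoly a₁ b₁ a₂ b₂) = u * (u - 1 / 2) ^ 2 := by
  obtain ⟨v, hv⟩ : ∃ v, v = b₂ * Real.cos (2 * θ) - a₂ * Real.sin (2 * θ) := ⟨_, rfl⟩
  have huv := sq_add_sq_eq_of_eq_cos_sin hu hv
  rw [eval_secondHarmonicPoly, supportParam_quadraticSupport hu hv]
  simp only [Matrix.cons_val_zero, Matrix.cons_val_one, Matrix.cons_val_fin_one,
    add_sub_cancel_left]
  rw [Real.cos_two_mul', Real.sin_two_mul] at hu hv
  linear_combination -((1 / 2 + u) ^ 2 - 4 * v ^ 2) * hu - 4 * (1 / 2 + u) * v * hv + 2 * huv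

/-- A sextic through the curve of `quadraticSupport`: it eliminates `u = a₂ cos 2θ + b₂ sin 2θ` from
the values `S = (1/2 + u)² - 4u²` and `Q = u (u - 1/2)²` of the two quadratic polynomials. -/
noncomputable def quadraticSupportSextic (a₁ b₁ a₂ b₂ : ℝ) : MvPolynomial (Fin 2) ℝ :=
  let S := circlePoly !₂[a₁, b₁] (4 * (a₂ ^ 2 + b₂ ^ 2))
  let Q := secondHarmonicPoly a₁ b₁ a₂ b₂
  (4 : ℝ) • S ^ 3 - S ^ 2 - (36 : ℝ) • (S * Q) + (108 : ℝ) • Q ^ 2 + (8 : ℝ) • Q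

theorem totalDegree_quadraticSupportSextic_le :
    (quadraticSupportSextic a₁ b₁ a₂ b₂).totalDegree ≤ 6 := by
  have hS := totalDegree_circlePoly_le !₂[a₁, b₁] (4 * (a₂ ^ 2 + b₂ ^ 2))
  have hQ := totalDegree_secondHarmonicPoly_le (a₁ := a₁) (b₁ := b₁) (a₂ := a₂) (b₂ := b₂)
  have hpow {f : MvPolynomial (Fin 2) ℝ} (hf : f.totalDegree ≤ 2) (n : ℕ) :
      (f ^ n).totalDegree ≤ n * 2 :=
    (MvPolynomial.totalDegree_pow _ _).trans (Nat.mul_le_mul_left n hf)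
  have hcube := (MvPolynomial.totalDegree_smul_le (4 : ℝ) _).trans (hpow hS 3)
  have hsq := (hpow hS 2).trans (by norm_num : 2 * 2 ≤ 6)
  have hmul := (MvPolynomial.totalDegree_smul_le (36 : ℝ) _).trans <|
    (MvPolynomial.totalDegree_mul _ _).trans ((add_le_add hS hQ).trans (by norm_num : 2 + 2 ≤ 6))
  have hsq' := (MvPolynomial.totalDegree_smul_le (108 : ℝ) _).trans <|
    (hpow hQ 2).trans (by norm_num : 2 * 2 ≤ 6)
  have hlin := (MvPolynomial.totalDegree_smul_le (8 : ℝ) _).trans (hQ.trans (by norm_num : 2 ≤ 6))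
  exact (MvPolynomial.totalDegree_add _ _).trans <| max_le
    ((MvPolynomial.totalDegree_add _ _).trans <| max_le
      ((MvPolynomial.totalDegree_sub _ _).trans <| max_le
        ((MvPolynomial.totalDegree_sub _ _).trans <| max_le hcube hsq) hmul) hsq') hlin

theorem eval_supportParam_quadraticSupportSextic (θ : ℝ) :
    MvPolynomial.eval (fun i => supportParam (quadraticSupport a₁ b₁ a₂ b₂) θ i)
      (quadraticSupportSextic a₁ b₁ a₂ b₂) = 0 := by
  simp only [quadraticSupportSextic, map_add, map_sub, map_mul, map_pow, MvPolynomial.smul_eval,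
    eval_supportParam_circlePoly rfl, eval_supportParam_secondHarmonicPoly rfl]
  ring

theorem quadraticSupportSextic_ne_zero : quadraticSupportSextic a₁ b₁ a₂ b₂ ≠ 0 := by
  intro h
  have hplane (z : Plane) := congrArg (MvPolynomial.eval fun i => z i) h
  simp only [quadraticSupportSextic, map_add, map_sub, map_mul, map_pow, MvPolynomial.smul_eval,
    eval_circlePoly, eval_secondHarmonicPoly, map_zero] at hplane
  have heval (x : ℝ) := hplane !₂[a₁ + x, b₁]
  simp only [Matrix.cons_val_zero, Matrix.cons_val_one, Matrix.cons_val_fin_one,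
    add_sub_cancel_left, sub_self] at heval
  -- On `y = b₁` the sextic is an even polynomial in `x - a₁` with leading coefficient `4`, which is
  -- recovered from the values at `0, 1, 2, 3`.
  have : (4 : ℝ) = 0 := by
    linear_combination -(heval 0) / 36 + heval 1 / 24 - heval 2 / 60 + heval 3 / 360
  norm_num at this

theorem totalDegree_eq_six_of_isDefiningPolynomial (h : a₂ ≠ 0 ∨ b₂ ≠ 0)
    {f : MvPolynomial (Fin 2) ℝ}
    (hf : IsDefiningPolynomial f (supportCurve (quadraticSupport a₁ b₁ a₂ b₂))) :
    f.totalDegree = 6 := by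
  have hsextic : f ∣ quadraticSupportSextic a₁ b₁ a₂ b₂ :=
    (hf.2 _).mp <| Set.forall_mem_image.mpr fun θ _ => eval_supportParam_quadraticSupportSextic θ
  refine le_antisymm ?_ ((isRotorSpectrum_const_add_laurentHarmonic_two h)
    |>.six_le_totalDegree_of_isDefiningPolynomial hasLaurentExpansion_quadraticSupport hf)
  exact (MvPolynomial.totalDegree_le_of_dvd_of_isDomain hsextic
    quadraticSupportSextic_ne_zero).trans totalDegree_quadraticSupportSextic_le

theorem quadraticSupport_isAlgebraicRotor_and_sextic (h : a₂ ≠ 0 ∨ b₂ ≠ 0)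
    (hconv : ConvexityConstraint (quadraticSupport a₁ b₁ a₂ b₂)) :
    IsAlgebraicRotor 3 (1 / 2) (supportCurve (quadraticSupport a₁ b₁ a₂ b₂)) ∧
      ¬ IsCircle (supportCurve (quadraticSupport a₁ b₁ a₂ b₂)) ∧
      ∃ f, IsDefiningPolynomial f (supportCurve (quadraticSupport a₁ b₁ a₂ b₂)) ∧
        f.totalDegree = 6 := by
  have hspectrum := isRotorSpectrum_const_add_laurentHarmonic_two h
  have hexpansion :=
    hasLaurentExpansion_quadraticSupport (a₁ := a₁) (b₁ := b₁) (a₂ := a₂) (b₂ := b₂)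
  obtain ⟨f, hf⟩ := hspectrum.exists_isDefiningPolynomial hexpansion
  exact ⟨isAlgebraicRotor_quadraticSupport hconv, hspectrum.not_isCircle hexpansion, f, hf,
    totalDegree_eq_six_of_isDefiningPolynomial h hf⟩

end Sextic

theorem mainTheorem6 :
    -- every non-circular algebraic rotor has a defining polynomial
    (∀ C ∈ algebraicRotors, ¬ IsCircle C → ∃ f, IsDefiningPolynomial f C) ∧
    -- the minimal total degree of these polynomials is 6
    IsLeast {d : ℕ | ∃ C ∈ algebraicRotors, ¬ IsCircle C ∧
      ∃ f, IsDefiningPolynomial f C ∧ f.totalDegree = d} 6 ∧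
    -- it is attained by every member of the family that satisfies the convexity constraint
    (∀ a₁ b₁ a₂ b₂ : ℝ, (a₂ ≠ 0 ∨ b₂ ≠ 0) →
      ConvexityConstraint (quadraticSupport a₁ b₁ a₂ b₂) →
      IsAlgebraicRotor 3 (1 / 2) (supportCurve (quadraticSupport a₁ b₁ a₂ b₂)) ∧
      ¬ IsCircle (supportCurve (quadraticSupport a₁ b₁ a₂ b₂)) ∧
      ∃ f, IsDefiningPolynomial f (supportCurve (quadraticSupport a₁ b₁ a₂ b₂)) ∧
        f.totalDegree = 6) ∧
    -- the convexity constraint holds as soon as the second harmonic is small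
    (∃ ε : ℝ, 0 < ε ∧ ∀ a₁ b₁ a₂ b₂ : ℝ, |a₂| < ε → |b₂| < ε →
      ConvexityConstraint (quadraticSupport a₁ b₁ a₂ b₂)) ∧
    -- the example p(θ) = 1/2 + (1/6) cos 2θ
    (ConvexityConstraint (fun θ : ℝ => 1 / 2 + 1 / 6 * Real.cos (2 * θ)) ∧
      IsAlgebraicRotor 3 (1 / 2)
        (supportCurve (fun θ : ℝ => 1 / 2 + 1 / 6 * Real.cos (2 * θ))) ∧
      ¬ IsCircle (supportCurve (fun θ : ℝ => 1 / 2 + 1 / 6 * Real.cos (2 * θ))) ∧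
      ∃ f, IsDefiningPolynomial f
          (supportCurve (fun θ : ℝ => 1 / 2 + 1 / 6 * Real.cos (2 * θ))) ∧
        f.totalDegree = 6) := by
  have hexample :
      (fun θ : ℝ => 1 / 2 + 1 / 6 * Real.cos (2 * θ)) = quadraticSupport 0 0 (1 / 6) 0 := by
    funext θ
    simp [quadraticSupport]
  have hconv : ConvexityConstraint (quadraticSupport 0 0 (1 / 6) 0) :=
    convexityConstraint_quadraticSupport (by norm_num)
  have hsextic := quadraticSupport_isAlgebraicRotor_and_sextic (.inl (by norm_num)) hconv
  rw [hexample]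
  refine ⟨fun C hC hcircle => ?_, ⟨⟨_, ⟨3, 1 / 2, hsextic.1⟩, hsextic.2⟩, ?_⟩,
    fun a₁ b₁ a₂ b₂ => quadraticSupport_isAlgebraicRotor_and_sextic,
    ⟨1 / 12, by norm_num, fun a₁ b₁ a₂ b₂ ha hb =>
      convexityConstraint_quadraticSupport (by linarith)⟩, hconv, hsextic⟩
  · obtain ⟨p, P, N, α, β, rfl, hspectrum, hexpansion⟩ :=
      exists_isRotorSpectrum_of_mem_algebraicRotors hC hcircle
    exact hspectrum.exists_isDefiningPolynomial hexpansion
  · rintro d ⟨C, hC, hcircle, f, hf, rfl⟩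
    obtain ⟨p, P, N, α, β, rfl, hspectrum, hexpansion⟩ :=
      exists_isRotorSpectrum_of_mem_algebraicRotors hC hcircle
    exact hspectrum.six_le_totalDegree_of_isDefiningPolynomial hexpansion hf
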